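/- A maya diagram is a sequence of integers $[x_1,x_2,\ldots]$ with $x_1>x_2>\cdots$ and $x_i=-i$ for $i\gg 1$; it corresponds to the partition $(x_1+1,x_2+2,\ldots)$. Let $F$ be the $\mathbb{C}$-vector space having the maya diagrams as a basis. A sequence of integers $[x_1,x_2,\ldots]$ with $x_i=-i$ for $i\gg1$ that is not necessarily decreasing is regarded as an element of $F$ by the rule $[\ldots,i,\ldots,j,\ldots]=-[\ldots,j,\ldots,i,\ldots]$ (so it is $0$ if it has a repeated term). For $m\ge 1$ and $k\in\mathbb{Z}$ let $\phi_k^{(m)}:F\to F$ be the $\mathbb{C}$-linear operator defined on maya diagrams by $$\phi_k^{(m)}([x_1,x_2,\ldots])=\sum_{a_0,\ldots,a_{m-1}}[a_{m-1}-m,\,a_{m-2}-m,\,\ldots,\,a_0-m,\,x_1-m,\,x_2-m,\,\ldots],$$ where the sum is over all $m$-tuples of integers with $a_i\equiv i \pmod m$ and $a_0+\cdots+a_{m-1}=(0+1+\cdots+(m-1))-km$; only finitely many terms are nonzero. Let $\Lambda_{\mathbb{C}}$ be the ring of symmetric functions over $\mathbb{C}$ in the variables $X_1,X_2,\ldots$,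 with complete symmetric functions $h_r$ and elementary symmetric functions $e_r$ (where $h_0=e_0=1$ and $h_r=e_r=0$ for $r<0$), and with Schur functions $s_\lambda$. Let $\langle\cdot,\cdot\rangle$ be the Hall inner product, that is the bilinear form with $\langle s_\lambda,s_\mu\rangle=\delta_{\lambda\mu}$, and let $f^\perp$ be the adjoint of the multiplication by $f$, so that $\langle f^\perp g,k\rangle=\langle g,fk\rangle$. For $m\ge1$ let $(f\circ p_m)(X_1,X_2,\ldots)=f(X_1^m,X_2^m,\ldots)$ be the plethysm with the power sum $p_m$. **Theorem.** The Schur functions form a basis of $\Lambda_{\mathbb{C}}$, so that the linear map which sends each maya diagram to the Schur function of the corresponding partition identifies $F$ with $\Lambda_{\mathbb{C}}$, and for every $f\in\Lambda_{\mathbb{C}}$ the adjoint $f^\perp$ exists. Under this identification, for all $m\ge 1$ and $n\in\mathbb{Z}$, $$\phi_{-n}^{(m)}=\sum_{i\ge 0}(-1)^i\,(h_{n+i}\circ p_m)\,(e_i\circ p_m)^\perp ,$$ where $h_{n+i}\circ p_m$ stands for the operator of multiplication by it, and where only finitely many terms of the sum are nonzero on each given element of $\Lambda_{\mathbb{C}}$.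 -/

import Mathlib

noncomputable section

/-! ### Maya diagrams and the operators `φ_k^{(m)}` -/

/-- A maya diagram `[x₁, x₂, …]`: a strictly decreasing sequence of integers with `x_i = -i` for
`i ≫ 1`. Sequences are indexed from `0` here, so `seq i` is `x_{i+1}`. -/
structure MayaDiagram where
  seq : ℕ → ℤ
  strictAnti : StrictAnti seq
  eventually_eq : ∃ N : ℕ, ∀ i, N ≤ i → seq i = -((i : ℤ) + 1)

/-- The space `F`: the complex vector space with basis the maya diagrams. -/
abbrev FockSpace : Type := MayaDiagram →₀ ℂ

/-- The number of inversions of a sequence, that is of the pairs `i < j` whose entries are not in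
decreasing order. -/
def seqInversions (x : ℕ → ℤ) : ℕ :=
  Set.ncard {p : ℕ × ℕ | p.1 < p.2 ∧ x p.1 < x p.2}

open Classical in
/-- The element of `F` denoted by a not necessarily decreasing sequence `[x₁, x₂, …]` with
`x_i = -i` for `i ≫ 1`. Since interchanging two entries changes the sign, it is `0` if there is a
repeated entry, and otherwise it is `(-1)^{#inversions}` times the maya diagram having the same
set of entries. -/
def bracket (x : ℕ → ℤ) : FockSpace :=
  if h : Function.Injective x ∧ ∃ y : MayaDiagram, Set.range y.seq = Set.range x then
    Finsupp.single h.2.choose ((-1 : ℂ) ^ seqInversions x)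
  else 0

/-- The set of all `m`-tuples of integers `(a₀, …, a_{m-1})` with `a_i ≡ i (mod m)` and
`a₀ + ⋯ + a_{m-1} = (0 + ⋯ + (m-1)) - k m`. -/
def phiIndex (m : ℕ) (k : ℤ) : Set (Fin m → ℤ) :=
  {a | (∀ i : Fin m, a i ≡ (i : ℤ) [ZMOD (m : ℤ)]) ∧
    ∑ i : Fin m, a i = (∑ i : Fin m, (i : ℤ)) - k * m}

/-- The sequence `[a_{m-1}, …, a₀, x₁, x₂, …] - m`, where `m` is subtracted from each entry. -/
def prependShift {m : ℕ} (a : Fin m → ℤ) (x : ℕ → ℤ) : ℕ → ℤ := fun j =>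
  (if h : j < m then a (Fin.rev ⟨j, h⟩) else x (j - m)) - m

/-- Only finitely many tuples contribute to the sum that defines `φ_k^{(m)}`. -/
theorem finite_support_phi (m : ℕ) (k : ℤ) (x : MayaDiagram) :
    (Function.support fun a : phiIndex m k => bracket (prependShift a.1 x.seq)).Finite := by
  obtain ⟨N, hN⟩ := x.eventually_eq
  set L : ℤ := -((N : ℤ) + 1) with hL
  set T : ℤ := (∑ i : Fin m, (i : ℤ)) - k * m with hT
  refine Set.Finite.of_finite_image
    (f := fun a : phiIndex m k => a.1) ?_ Subtype.val_injective.injOn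
  refine (Set.finite_Icc (fun _ : Fin m => L) (fun _ => L + (T - m * L))).subset ?_
  rintro _ ⟨⟨a, ha⟩, hs, rfl⟩
  have hinj : Function.Injective (prependShift a x.seq) := by
    by_contra hc
    exact hs (by simp [bracket, hc])
  have hlow : ∀ i, L ≤ a i := by
    intro i
    by_contra hlt
    push Not at hlt
    have hi : prependShift a x.seq (Fin.rev i).1 = a i - m := by
      simp only [prependShift, (Fin.rev i).2, dif_pos, Fin.eta, Fin.rev_rev]
    have hq : prependShift a x.seq (m + (-(a i) - 1).toNat) = a i - m := by
      have h1 : ((-(a i) - 1).toNat : ℤ) = -(a i) - 1 := Int.toNat_of_nonneg (by omega)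
      have h2 : N ≤ (-(a i) - 1).toNat := by omega
      simp only [prependShift, Nat.add_sub_cancel_left, hN _ h2, h1]
      simp
    have := hinj (hi.trans hq.symm)
    have h3 := (Fin.rev i).2
    omega
  have hsum : ∑ i, (a i - L) = T - m * L := by
    rw [Finset.sum_sub_distrib, ha.2]; simp [hT]
  refine ⟨hlow, fun i => ?_⟩
  have := Finset.single_le_sum (f := fun i => a i - L) (s := Finset.univ)
    (fun j _ => sub_nonneg.2 (hlow j)) (Finset.mem_univ i)
  simp only [hsum] at this
  show a i ≤ L + (T - m * L)
  linarith

/-- The linear operator `φ_k^{(m)} : F → F`, which sends a maya diagram `[x₁, x₂, …]` to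
`(∑ [a_{m-1}, …, a₀, x₁, x₂, …]) - m`, the sum being over the tuples in `phiIndex m k`. -/
def phi (m : ℕ) (k : ℤ) : FockSpace →ₗ[ℂ] FockSpace :=
  Finsupp.linearCombination ℂ fun x : MayaDiagram =>
    ∑ᶠ a : phiIndex m k, bracket (prependShift a.1 x.seq)

/-! ### Symmetric functions -/

/-- The ring `Λ_ℂ` of symmetric functions with complex coefficients in the variables
`X₁, X₂, …` (indexed by `ℕ`): the formal power series of bounded degree that are invariant under
all permutations of the variables. -/
def SymFun : Subalgebra ℂ (MvPowerSeries ℕ ℂ) where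
  carrier := {f | (∀ σ : Equiv.Perm ℕ, MvPowerSeries.renameEquiv ℂ σ f = f) ∧
    ∃ D : ℕ, ∀ d : ℕ →₀ ℕ, D < d.degree → MvPowerSeries.coeff d f = 0}
  mul_mem' := by
    rintro f g ⟨hf, D, hD⟩ ⟨hg, E, hE⟩
    refine ⟨fun σ => by rw [map_mul, hf, hg], D + E, fun d hd => ?_⟩
    classical
    rw [MvPowerSeries.coeff_mul]
    refine Finset.sum_eq_zero fun p hp => ?_
    have h1 : p.1.degree + p.2.degree = d.degree := by
      rw [← map_add, Finset.HasAntidiagonal.mem_antidiagonal.1 hp]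
    rcases lt_or_ge D p.1.degree with h | h
    · rw [hD _ h, zero_mul]
    · rw [hE _ (by omega), mul_zero]
  add_mem' := by
    rintro f g ⟨hf, D, hD⟩ ⟨hg, E, hE⟩
    refine ⟨fun σ => by rw [map_add, hf, hg], max D E, fun d hd => ?_⟩
    rw [map_add, hD _ (lt_of_le_of_lt (le_max_left _ _) hd),
      hE _ (lt_of_le_of_lt (le_max_right _ _) hd), add_zero]
  algebraMap_mem' := by
    intro r
    refine ⟨fun σ => AlgEquiv.commutes _ r, 0, fun d hd => ?_⟩
    classical
    have hd0 : d ≠ 0 := by rintro rfl; simp at hd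
    rw [MvPowerSeries.algebraMap_apply, MvPowerSeries.coeff_C, if_neg hd0]

theorem coeff_renameEquiv_perm (σ : Equiv.Perm ℕ) (f : MvPowerSeries ℕ ℂ) (d : ℕ →₀ ℕ) :
    MvPowerSeries.coeff (Finsupp.equivMapDomain σ d) (MvPowerSeries.renameEquiv ℂ σ f) =
      MvPowerSeries.coeff d f := by
  have h := MvPowerSeries.coeff_embDomain_rename (R := ℂ) σ.toEmbedding f d
  rw [Finsupp.embDomain_eq_mapDomain] at h
  rw [Finsupp.equivMapDomain_eq_mapDomain]
  exact h

theorem renameEquiv_eq_self {f : MvPowerSeries ℕ ℂ}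
    (hf : ∀ (σ : Equiv.Perm ℕ) (d : ℕ →₀ ℕ),
      MvPowerSeries.coeff (Finsupp.equivMapDomain σ d) f = MvPowerSeries.coeff d f)
    (σ : Equiv.Perm ℕ) : MvPowerSeries.renameEquiv ℂ σ f = f := by
  ext d
  obtain ⟨e, rfl⟩ := (Finsupp.equivCongrLeft (M := ℕ) σ).surjective d
  exact (coeff_renameEquiv_perm σ f e).trans (hf σ e).symm

theorem degree_equivMapDomain (σ : Equiv.Perm ℕ) (d : ℕ →₀ ℕ) :
    (Finsupp.equivMapDomain σ d).degree = d.degree := by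
  rw [Finsupp.equivMapDomain_eq_mapDomain]
  induction d using Finsupp.induction_linear with
  | zero => simp
  | add f g hf hg => rw [Finsupp.mapDomain_add, map_add, map_add, hf, hg]
  | single i n => rw [Finsupp.mapDomain_single, Finsupp.degree_single, Finsupp.degree_single]

/-- A power series whose coefficients are bounded in degree and invariant under permutations of
the exponents is a symmetric function. -/
theorem mem_symFun (c : (ℕ →₀ ℕ) → ℂ)
    (hc : ∀ (σ : Equiv.Perm ℕ) (d : ℕ →₀ ℕ), c (Finsupp.equivMapDomain σ d) = c d)
    (D : ℕ) (hD : ∀ d : ℕ →₀ ℕ, D < d.degree → c d = 0) :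
    (show MvPowerSeries ℕ ℂ from c) ∈ SymFun :=
  ⟨renameEquiv_eq_self hc, D, hD⟩

open Classical in
/-- The complete symmetric function `h_r`: the sum of all monomials of degree `r`. It is `1` for
`r = 0` and `0` for `r < 0`. -/
def hSym (r : ℤ) : SymFun :=
  ⟨fun d => if (d.degree : ℤ) = r then 1 else 0,
    mem_symFun _ (fun σ d => by simp only [degree_equivMapDomain]) r.toNat
      (fun d hd => if_neg (by omega))⟩

open Classical in
/-- The elementary symmetric function `e_r`: the sum of all square-free monomials of degree `r`.
It is `1` for `r = 0` and `0` for `r < 0`. -/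
def eSym (r : ℤ) : SymFun :=
  ⟨fun d => if (d.degree : ℤ) = r ∧ ∀ i, d i ≤ 1 then 1 else 0,
    mem_symFun _ (fun σ d => by
      simp only [degree_equivMapDomain, Finsupp.equivMapDomain_apply]
      rw [σ.symm.surjective.forall (p := fun i => d i ≤ 1)]) r.toNat
      (fun d hd => if_neg (fun h => by omega))⟩

/-- The plethysm `f ∘ p_m`, that is `(f ∘ p_m)(X₁, X₂, …) = f(X₁^m, X₂^m, …)`, for `m ≥ 1`. -/
def plethysmP (m : ℕ) (hm : 1 ≤ m) : SymFun →ₐ[ℂ] SymFun :=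
  ((MvPowerSeries.expand m (Nat.one_le_iff_ne_zero.1 hm)).comp SymFun.val).codRestrict SymFun <| by
    rintro ⟨f, hf, D, hD⟩
    have hm0 := Nat.one_le_iff_ne_zero.1 hm
    have key : ∀ d : ℕ →₀ ℕ, MvPowerSeries.coeff d (MvPowerSeries.expand m hm0 f) ≠ 0 →
        ∃ e : ℕ →₀ ℕ, d = m • e := by
      intro d hd
      have hdvd : ∀ i, m ∣ d i := fun i => by
        by_contra h
        exact hd (MvPowerSeries.coeff_expand_of_not_dvd m hm0 f h)
      refine ⟨d.mapRange (fun n => n / m) (Nat.zero_div m), ?_⟩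
      ext i
      simp [Nat.mul_div_cancel' (hdvd i)]
    have hsm : ∀ (σ : Equiv.Perm ℕ) (e : ℕ →₀ ℕ),
        Finsupp.equivMapDomain σ (m • e) = m • Finsupp.equivMapDomain σ e := by
      intro σ e; ext i; simp
    have hfc : ∀ (σ : Equiv.Perm ℕ) (e : ℕ →₀ ℕ),
        MvPowerSeries.coeff (Finsupp.equivMapDomain σ e) f = MvPowerSeries.coeff e f := by
      intro σ e
      conv_lhs => rw [← hf σ]
      exact coeff_renameEquiv_perm σ f e
    have hmul : ∀ (σ : Equiv.Perm ℕ) (e : ℕ →₀ ℕ),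
        MvPowerSeries.coeff (Finsupp.equivMapDomain σ (m • e)) (MvPowerSeries.expand m hm0 f) =
          MvPowerSeries.coeff (m • e) (MvPowerSeries.expand m hm0 f) := by
      intro σ e
      rw [hsm, MvPowerSeries.coeff_expand_smul, MvPowerSeries.coeff_expand_smul, hfc]
    refine ⟨renameEquiv_eq_self fun σ d => ?_, m * D, fun d hd => ?_⟩
    · by_cases h : ∃ e : ℕ →₀ ℕ, d = m • e
      · obtain ⟨e, rfl⟩ := h
        exact hmul σ e
      · have h1 : MvPowerSeries.coeff d (MvPowerSeries.expand m hm0 f) = 0 := by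
          by_contra h1; exact h (key d h1)
        have h2 : MvPowerSeries.coeff (Finsupp.equivMapDomain σ d)
            (MvPowerSeries.expand m hm0 f) = 0 := by
          by_contra h2
          obtain ⟨e, he⟩ := key _ h2
          refine h ⟨Finsupp.equivMapDomain σ.symm e, ?_⟩
          rw [← hsm, ← he]
          ext i; simp
        exact h2.trans h1.symm
    · by_contra h
      obtain ⟨e, rfl⟩ := key d h
      rw [map_nsmul, smul_eq_mul] at hd
      refine h ?_
      have := hD e (lt_of_mul_lt_mul_left hd (Nat.zero_le m))
      exact (MvPowerSeries.coeff_expand_smul m hm0 f e).trans this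

/-- The part `λ_{i+1} = x_{i+1} + (i + 1)` of the partition that corresponds to the maya diagram
`[x₁, x₂, …]`. -/
def MayaDiagram.part (x : MayaDiagram) (i : ℕ) : ℤ := x.seq i + (i + 1)

theorem MayaDiagram.exists_part_eq_zero (x : MayaDiagram) :
    ∃ l : ℕ, ∀ i, l ≤ i → x.part i = 0 := by
  obtain ⟨N, hN⟩ := x.eventually_eq
  exact ⟨N, fun i hi => by rw [MayaDiagram.part, hN i hi]; ring⟩

open Classical in
/-- The length (number of nonzero parts) of the corresponding partition. -/
def MayaDiagram.length (x : MayaDiagram) : ℕ := Nat.find x.exists_part_eq_zero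

/-- The Schur function `s_λ = det (h_{λ_i - i + j})_{1 ≤ i, j ≤ ℓ(λ)}`, indexed by a maya
diagram. -/
def schur (x : MayaDiagram) : SymFun :=
  (Matrix.of fun i j : Fin x.length => hSym (x.part i - (i : ℤ) + (j : ℤ))).det

/-- The linear map `F → Λ_ℂ` which sends each maya diagram `λ` to the Schur function `s_λ`. It is
the map by which the two spaces are identified. -/
def schurMap : FockSpace →ₗ[ℂ] SymFun := Finsupp.linearCombination ℂ schur

/-- The Hall inner product, extended bilinearly to `Λ_ℂ`: the pairing for which the Schur functions
are orthonormal, computed from the coordinates with respect to the Schur functions. (It presupposes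
that these form a basis, that is that `schurMap` is bijective.) -/
def hallInner (f g : SymFun) : ℂ :=
  (Function.invFun schurMap f).sum fun x c => c * Function.invFun schurMap g x

open Classical in
/-- `f^⊥`: the adjoint, with respect to the Hall inner product, of the multiplication by `f`
(with the value `0` if there were no adjoint). -/
def perp (f : SymFun) : SymFun →ₗ[ℂ] SymFun :=
  if h : ∃ D : SymFun →ₗ[ℂ] SymFun, ∀ g k, hallInner (D g) k = hallInner g (f * k) then
    h.choose
  else 0

end

/-!
In `N` variables the Jacobi–Trudi determinant `s[x] = det (h_{x_i + k})` of a sequence `x` satisfies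
`s[x] a_δ = a_{x + N}` (`finVars_jacobi_mul_alternant`), where `a_β = det (X_i ^ β_j)`. Being
alternating in the entries of `x`, it is the image of the bracket `[x₁, x₂, …]` in `Λ`
(`schurMap_bracket`).

*Basis.* For a symmetric function `f`, the product `f a_δ` is antisymmetric, hence the combination
of the alternants whose coefficients are its own coefficients at the strictly decreasing exponents.
After division by `a_δ` this writes `f` as a combination of Schur functions, and the coefficient of
`s_x` in `f` is that of `X^{x + N}` in `f a_δ`, for every `N` which is at least the length of `x`.

*Adjoints.* The coefficient of `X^γ` in `a_β` is symmetric in `β` and `γ`. So if `f = ∑ f_α X^α` in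
`N` variables, then `f^⊥ s_x = ∑ f_α s[x - α]` (`hallInner_perpSchur`). In particular
`(e_i ∘ p_m)^⊥ s_x` is the sum of the `s[x - m 1_S]` over the sets `S` of `i` indices
(`perp_plethysmP_eSym_schur`).

*The formula.* Collect the sums over `k` in a generating function in `z`. By multilinearity, the
generating function of `φ s_x` is, up to a power of `z`, a determinant of size `m + L`. It has `m`
rows `(g_{c - r})_c`, where the `g_s` are the series formed from the `h_r` with `r ≡ s` modulo `m`
and satisfy `g_{s + m} = z⁻¹ g_s`, and `L` rows `(h_{x_i - m + c + 1})_c`. Subtracting `z⁻¹` times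
the column `c - m` from each column `c ≥ m` makes the first rows vanish there
(`det_residueSeries_fromRows`), so the determinant is the product of two others. The first is the
circulant determinant of the `g_{c - r}`; in finitely many variables its factors come from
`det (1 - X_i P) = 1 - X_i^m z`, for the cyclic shift `P` with `P^m = z`, and it is the generating
function of the `h_n ∘ p_m` (`det_residueSeries_hSym`). The second has the entries
`h_{x_i + k} - z⁻¹ h_{x_i - m + k}` and expands to the sum of the `(-z⁻¹)^{|S|} s[x - m 1_S]`, in
which `(e_i ∘ p_m)^⊥ s_x` is recognized. To remain within power series, everything is multiplied by
a suitable power of `z`.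
-/

/-! ### Restriction to finitely many variables -/

/-- The restriction of a symmetric function to the variables `X₀, …, X_{N-1}`, the others being
set to `0`. -/
noncomputable def finVars (N : ℕ) : SymFun →ₐ[ℂ] MvPowerSeries (Fin N) ℂ :=
  (MvPowerSeries.killCompl Fin.valEmbedding).comp SymFun.val

theorem coeff_finVars (N : ℕ) (f : SymFun) (d : Fin N →₀ ℕ) :
    MvPowerSeries.coeff d (finVars N f) =
      MvPowerSeries.coeff (Finsupp.embDomain Fin.valEmbedding d) f.1 := rfl

theorem degree_embDomain {σ τ : Type*} (e : σ ↪ τ) (d : σ →₀ ℕ) :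
    (Finsupp.embDomain e d).degree = d.degree := by
  simp [Finsupp.degree_apply, Finsupp.support_embDomain]

theorem embDomain_all_iff {σ τ : Type*} (e : σ ↪ τ) (d : σ →₀ ℕ) {p : ℕ → Prop} (hp : p 0) :
    (∀ i, p (Finsupp.embDomain e d i)) ↔ ∀ i, p (d i) := by
  refine ⟨fun h i => by simpa using h (e i), fun h i => ?_⟩
  by_cases hi : i ∈ Set.range e
  · obtain ⟨j, rfl⟩ := hi
    simpa using h j
  · rwa [Finsupp.embDomain_of_notMem_range _ _ _ hi]

/-- A finitely supported exponent on `ℕ` involves only the first `N` variables for `N` large. -/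
theorem exists_embDomain_fin (d : ℕ →₀ ℕ) :
    ∃ (N : ℕ) (e : Fin N →₀ ℕ), Finsupp.embDomain Fin.valEmbedding e = d := by
  refine ⟨d.support.sup id + 1, d.comapDomain _ Fin.valEmbedding.injective.injOn, ?_⟩
  refine Finsupp.embDomain_comapDomain fun i hi => ?_
  exact ⟨⟨i, Nat.lt_succ_of_le (Finset.le_sup (f := id) hi)⟩, rfl⟩

theorem symFun_ext_finVars {f g : SymFun} (h : ∀ N, finVars N f = finVars N g) : f = g := by
  apply Subtype.ext
  ext d
  obtain ⟨N, e, rfl⟩ := exists_embDomain_fin d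
  rw [← coeff_finVars, h, coeff_finVars]

theorem coeff_plethysmP {m : ℕ} (hm : 1 ≤ m) (f : SymFun) (d : ℕ →₀ ℕ) :
    MvPowerSeries.coeff (m • d) (plethysmP m hm f).1 = MvPowerSeries.coeff d f.1 :=
  MvPowerSeries.coeff_expand_smul m (Nat.one_le_iff_ne_zero.1 hm) f.1 d

theorem coeff_plethysmP_of_not_dvd {m : ℕ} (hm : 1 ≤ m) (f : SymFun) {d : ℕ →₀ ℕ}
    (h : ¬ ∀ i, m ∣ d i) : MvPowerSeries.coeff d (plethysmP m hm f).1 = 0 := by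
  push Not at h
  obtain ⟨i, hi⟩ := h
  exact MvPowerSeries.coeff_expand_of_not_dvd m (Nat.one_le_iff_ne_zero.1 hm) f.1 hi

open Classical in
/-- The complete symmetric function `h_r` of the variables `X_i ^ m`, `i ∈ S`. -/
noncomputable def completeIn {N : ℕ} (m : ℕ) (S : Finset (Fin N)) (r : ℤ) :
    MvPowerSeries (Fin N) ℂ :=
  fun d => if (d.degree : ℤ) = m * r ∧ (∀ i, m ∣ d i) ∧ ∀ i ∉ S, d i = 0 then 1 else 0

open Classical in
theorem coeff_completeIn {N : ℕ} (m : ℕ) (S : Finset (Fin N)) (r : ℤ) (d : Fin N →₀ ℕ) :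
    MvPowerSeries.coeff d (completeIn m S r) =
      if (d.degree : ℤ) = m * r ∧ (∀ i, m ∣ d i) ∧ ∀ i ∉ S, d i = 0 then 1 else 0 := rfl

open Classical in
theorem coeff_hSym (r : ℤ) (d : ℕ →₀ ℕ) :
    MvPowerSeries.coeff d (hSym r).1 = if (d.degree : ℤ) = r then 1 else 0 := rfl

open Classical in
theorem coeff_eSym (r : ℤ) (d : ℕ →₀ ℕ) :
    MvPowerSeries.coeff d (eSym r).1 = if (d.degree : ℤ) = r ∧ ∀ i, d i ≤ 1 then 1 else 0 := rfl

theorem exists_eq_nsmul {σ : Type*} {m : ℕ} {d : σ →₀ ℕ} (h : ∀ i, m ∣ d i) :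
    ∃ e : σ →₀ ℕ, d = m • e := by
  refine ⟨d.mapRange (fun n => n / m) (Nat.zero_div m), ?_⟩
  ext i
  simp [Nat.mul_div_cancel' (h i)]

theorem finVars_plethysmP_hSym (N : ℕ) {m : ℕ} (hm : 1 ≤ m) (r : ℤ) :
    finVars N (plethysmP m hm (hSym r)) = completeIn m Finset.univ r := by
  classical
  ext d
  rw [coeff_finVars, coeff_completeIn]
  by_cases h : ∀ i, m ∣ d i
  · obtain ⟨e, he⟩ :=
      exists_eq_nsmul ((embDomain_all_iff Fin.valEmbedding d (dvd_zero m)).2 h)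
    rw [← degree_embDomain Fin.valEmbedding, he, coeff_plethysmP, coeff_hSym, map_nsmul]
    have hm0 : m ≠ 0 := by omega
    simp [h, hm0]
  · rw [coeff_plethysmP_of_not_dvd hm, if_neg (fun h' => h h'.2.1)]
    rwa [embDomain_all_iff Fin.valEmbedding d (dvd_zero m)]

theorem finVars_hSym (N : ℕ) (r : ℤ) :
    finVars N (hSym r) = completeIn 1 Finset.univ r := by
  classical
  ext d
  rw [coeff_finVars, coeff_completeIn, coeff_hSym, degree_embDomain]
  simp

theorem finVars_plethysmP_eSym (N : ℕ) {m : ℕ} (hm : 1 ≤ m) (r : ℕ) :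
    finVars N (plethysmP m hm (eSym r)) = ∑ S ∈ Finset.powersetCard r Finset.univ,
      MvPowerSeries.monomial (Finsupp.indicator S fun _ _ => m) (1 : ℂ) := by
  classical
  ext d
  have hm0 : m ≠ 0 := by omega
  rw [coeff_finVars, map_sum]
  simp only [MvPowerSeries.coeff_monomial]
  have key : ∀ S : Finset (Fin N), d = Finsupp.indicator S (fun _ _ => m) →
      S = d.support := by
    rintro S rfl
    ext i
    simp [Finsupp.indicator_apply, hm0]
  by_cases h : ∀ i, m ∣ d i
  · obtain ⟨e, rfl⟩ := exists_eq_nsmul h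
    have h1 : Finsupp.embDomain Fin.valEmbedding (m • e) =
        m • Finsupp.embDomain Fin.valEmbedding e := by
      simp only [Finsupp.embDomain_eq_mapDomain, Finsupp.mapDomain_smul]
    rw [h1, coeff_plethysmP, coeff_eSym, degree_embDomain,
      embDomain_all_iff Fin.valEmbedding e (p := fun n => n ≤ 1) (by simp)]
    by_cases h2 : ((e.degree : ℤ) = (r : ℤ) ∧ ∀ i, e i ≤ 1)
    · rw [if_pos h2]
      have h3 : m • e = Finsupp.indicator e.support (fun _ _ => m) := by
        ext i
        have := h2.2 i
        by_cases hi : e i = 0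
        · simp [Finsupp.indicator_apply, hi]
        · have : e i = 1 := by omega
          simp [Finsupp.indicator_apply, this]
      rw [Finset.sum_eq_single e.support, if_pos h3]
      · intro S _ hS
        rw [if_neg]
        intro h4
        rw [key S h4, Finsupp.support_smul_eq hm0] at hS
        exact hS rfl
      · intro hS
        refine absurd ?_ hS
        rw [Finset.mem_powersetCard]
        refine ⟨Finset.subset_univ _, ?_⟩
        have h5 : e.degree = r := by exact_mod_cast h2.1
        rw [← h5, Finsupp.degree_apply, Finset.card_eq_sum_ones]
        refine Finset.sum_congr rfl fun i hi => ?_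
        have := h2.2 i
        have := Finsupp.mem_support_iff.1 hi
        omega
    · rw [if_neg h2]
      symm
      refine Finset.sum_eq_zero fun S hS => if_neg fun h4 => h2 ?_
      have h5 : ∀ i, e i = if i ∈ S then 1 else 0 := by
        intro i
        have := DFunLike.congr_fun h4 i
        simp only [Finsupp.smul_apply, smul_eq_mul, Finsupp.indicator_apply] at this
        split_ifs at this ⊢ with hi
        · simpa [hm0] using this
        · simpa [hm0] using this
      refine ⟨?_, fun i => by rw [h5]; split_ifs <;> simp⟩
      rw [Finsupp.degree_eq_sum]
      simp only [h5]
      simp [(Finset.mem_powersetCard.1 hS).2]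
  · rw [coeff_plethysmP_of_not_dvd hm]
    · symm
      refine Finset.sum_eq_zero fun S hS => if_neg ?_
      rintro rfl
      refine h fun i => ?_
      rw [Finsupp.indicator_apply]
      split_ifs <;> simp
    · rwa [embDomain_all_iff Fin.valEmbedding d (dvd_zero m)]

theorem completeIn_neg {N m : ℕ} (hm : 1 ≤ m) (S : Finset (Fin N)) {r : ℤ} (hr : r < 0) :
    completeIn m S r = 0 := by
  classical
  ext d
  rw [coeff_completeIn, if_neg]
  · simp
  · rintro ⟨h, -⟩
    have : (m : ℤ) * r < 0 := mul_neg_of_pos_of_neg (by omega) hr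
    omega

theorem completeIn_empty {N m : ℕ} (hm : 1 ≤ m) (r : ℤ) :
    completeIn m (∅ : Finset (Fin N)) r = if r = 0 then 1 else 0 := by
  classical
  ext d
  have hm0 : m ≠ 0 := by omega
  rw [coeff_completeIn]
  by_cases hd : d = 0
  · subst hd
    by_cases hr : r = 0
    · simp [hr]
    · simp [hr, hm0]
  · rw [if_neg]
    · split_ifs <;> simp [MvPowerSeries.coeff_one, hd]
    · rintro ⟨-, -, h⟩
      exact hd (Finsupp.ext fun i => h i (by simp))

/-- A monomial in the `X_j ^ m`, `j ∈ S`, either is divisible by `X_i ^ m` or does not involve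
`X_i`. -/
theorem completeIn_eq_erase_add {N m : ℕ} (hm : 1 ≤ m) {S : Finset (Fin N)} {i : Fin N}
    (hi : i ∈ S) (r : ℤ) :
    completeIn m S r = completeIn m (S.erase i) r +
      MvPowerSeries.X i ^ m * completeIn m S (r - 1) := by
  classical
  ext d
  rw [map_add, MvPowerSeries.X_pow_eq, MvPowerSeries.coeff_monomial_mul]
  simp only [coeff_completeIn, one_mul]
  by_cases h0 : d i = 0
  · have h1 : ¬ Finsupp.single i m ≤ d := by
      intro h
      have := h i
      simp only [Finsupp.single_eq_same] at this
      omega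
    rw [if_neg h1, add_zero]
    congr 1
    refine propext (and_congr_right fun _ => and_congr_right fun _ => forall_congr' fun j => ?_)
    rw [Finset.mem_erase]
    by_cases hj : j = i
    · subst hj; simp [hi, h0]
    · simp [hj]
  · have h2 : ¬ ((d.degree : ℤ) = m * r ∧ (∀ i, m ∣ d i) ∧ ∀ j ∉ S.erase i, d j = 0) :=
      fun h => h0 (h.2.2 i (by simp))
    rw [if_neg h2, zero_add]
    by_cases h1 : Finsupp.single i m ≤ d
    · obtain ⟨e, rfl⟩ := exists_add_of_le h1
      rw [if_pos h1, add_tsub_cancel_left]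
      congr 1
      refine propext (and_congr ?_ (and_congr (forall_congr' fun j => ?_)
        (forall_congr' fun j => ?_)))
      · rw [map_add, Finsupp.degree_single]
        push_cast
        rw [mul_sub, mul_one]
        constructor <;> intro h <;> linarith
      · rw [Finsupp.add_apply, Finsupp.single_apply]
        split_ifs <;> simp
      · refine imp_congr_right fun hj => ?_
        rw [Finsupp.add_apply, Finsupp.single_apply, if_neg (by rintro rfl; exact hj hi),
          zero_add]
    · rw [if_neg h1, if_neg]
      rintro ⟨-, h, -⟩
      exact h1 (by
        rw [Finsupp.single_le_iff]
        exact Nat.le_of_dvd (Nat.pos_of_ne_zero h0) (h i))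

theorem completeIn_singleton {N : ℕ} (i : Fin N) (r : ℕ) :
    completeIn 1 {i} (r : ℤ) = MvPowerSeries.X i ^ r := by
  induction r with
  | zero =>
    rw [completeIn_eq_erase_add le_rfl (Finset.mem_singleton_self i),
      completeIn_neg le_rfl _ (r := ((0 : ℕ) : ℤ) - 1) (by simp)]
    simp [completeIn_empty]
  | succ r ih =>
    rw [completeIn_eq_erase_add le_rfl (Finset.mem_singleton_self i)]
    have : ((r + 1 : ℕ) : ℤ) - 1 = r := by push_cast; ring
    have h0 : ((r + 1 : ℕ) : ℤ) ≠ 0 := by omega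
    rw [this, ih]
    simp only [Finset.erase_singleton, completeIn_empty le_rfl, if_neg h0]
    rw [zero_add, pow_one, pow_succ']

/-- The generating function of the `h_r` is multiplied by `∏_{j ∈ T} (1 - X_j t)` when the
variables in `T` are removed; the `c k` are the coefficients of this polynomial. -/
theorem exists_completeIn_compl {N : ℕ} (T : Finset (Fin N)) :
    ∃ c : ℕ → MvPowerSeries (Fin N) ℂ, c 0 = 1 ∧ ∀ r : ℤ,
      completeIn 1 Tᶜ r = ∑ k ∈ Finset.range (T.card + 1),
        c k * completeIn 1 Finset.univ (r - k) := by
  classical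
  induction T using Finset.induction_on with
  | empty => exact ⟨fun _ => 1, rfl, fun r => by simp⟩
  | insert i T hi ih =>
    obtain ⟨c, hc0, hc⟩ := ih
    refine ⟨fun k => (if k < T.card + 1 then c k else 0) -
      (if k = 0 then 0 else MvPowerSeries.X i * c (k - 1)), by simp [hc0], fun r => ?_⟩
    have h1 := completeIn_eq_erase_add le_rfl (m := 1) (S := Tᶜ) (i := i) (by simpa using hi) r
    have h2 : (insert i T)ᶜ = Tᶜ.erase i := by rw [Finset.compl_insert]
    rw [h2, eq_sub_of_add_eq h1.symm, pow_one, Finset.card_insert_of_notMem hi]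
    simp only [sub_mul, Finset.sum_sub_distrib]
    congr 1
    · rw [Finset.sum_range_succ _ (T.card + 1), if_neg (lt_irrefl _), zero_mul, add_zero, hc]
      refine Finset.sum_congr rfl fun k hk => ?_
      rw [if_pos (Finset.mem_range.1 hk)]
    · rw [Finset.sum_range_succ' _ (T.card + 1), hc, Finset.mul_sum]
      simp only [if_pos, zero_mul, add_zero]
      refine Finset.sum_congr rfl fun k hk => ?_
      rw [if_neg (Nat.succ_ne_zero k), Nat.add_sub_cancel, mul_assoc]
      push_cast
      rw [sub_sub, add_comm (1 : ℤ)]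

/-! ### Alternants -/

/-- The alternant `a_β = det (X_i ^ β_j)`. -/
noncomputable def alternant {N : ℕ} (β : Fin N →₀ ℕ) : MvPowerSeries (Fin N) ℂ :=
  (Matrix.of fun i j : Fin N => (MvPowerSeries.X i : MvPowerSeries (Fin N) ℂ) ^ β j).det

theorem alternant_eq_sum {N : ℕ} (β : Fin N →₀ ℕ) :
    alternant β = ∑ σ : Equiv.Perm (Fin N), MvPowerSeries.monomial
      (Finsupp.equivMapDomain σ β) ((Equiv.Perm.sign σ : ℤ) : ℂ) := by
  classical
  rw [alternant, Matrix.det_apply']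
  refine Finset.sum_congr rfl fun σ _ => ?_
  have h : ∏ j, (Matrix.of fun i j : Fin N =>
      (MvPowerSeries.X i : MvPowerSeries (Fin N) ℂ) ^ β j) (σ j) j =
      MvPowerSeries.monomial (Finsupp.equivMapDomain σ β) 1 := by
    simp only [Matrix.of_apply, MvPowerSeries.X_pow_eq]
    have hs : ∑ j, Finsupp.single (σ j) (β j) = Finsupp.equivMapDomain σ β := by
      ext i
      rw [Finsupp.finsetSum_apply, Finset.sum_eq_single (σ.symm i)]
      · simp
      · intro j _ hj
        rw [Finsupp.single_apply, if_neg]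
        rintro rfl
        simp at hj
      · simp
    rw [MvPowerSeries.prod_monomial, hs, Finset.prod_const_one]
  rw [h, ← zsmul_eq_mul, ← map_zsmul, zsmul_one]

theorem coeff_alternant {N : ℕ} (β γ : Fin N →₀ ℕ) :
    MvPowerSeries.coeff γ (alternant β) = ∑ σ : Equiv.Perm (Fin N),
      if γ = Finsupp.equivMapDomain σ β then ((Equiv.Perm.sign σ : ℤ) : ℂ) else 0 := by
  classical
  simp only [alternant_eq_sum, map_sum, MvPowerSeries.coeff_monomial]

theorem coeff_alternant_comm {N : ℕ} (β γ : Fin N →₀ ℕ) :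
    MvPowerSeries.coeff γ (alternant β) = MvPowerSeries.coeff β (alternant γ) := by
  rw [coeff_alternant, coeff_alternant]
  refine Fintype.sum_equiv (Equiv.inv _) _ _ fun σ => ?_
  have : γ = Finsupp.equivMapDomain σ β ↔ β = Finsupp.equivMapDomain σ⁻¹ γ := by
    constructor
    · rintro rfl; ext i; simp [Equiv.Perm.inv_def]
    · rintro rfl; ext i; simp [Equiv.Perm.inv_def]
  simp [this]

theorem strictAnti_eq_of_range_eq {α β : Type*} [LinearOrder α] [WellFoundedLT α]
    [PartialOrder β] {f g : α → β} (hf : StrictAnti f) (hg : StrictAnti g)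
    (h : Set.range f = Set.range g) : f = g := by
  have := StrictMono.range_inj (f := OrderDual.toDual ∘ f) (g := OrderDual.toDual ∘ g)
    hf.dual_right hg.dual_right
  have h2 := this.1 (by rw [Set.range_comp, Set.range_comp, h])
  exact h2

theorem coeff_alternant_strictAnti {N : ℕ} {β γ : Fin N →₀ ℕ} (hβ : StrictAnti β)
    (hγ : StrictAnti γ) :
    MvPowerSeries.coeff γ (alternant β) = if γ = β then 1 else 0 := by
  classical
  rw [coeff_alternant, Finset.sum_eq_single 1]
  · have : Finsupp.equivMapDomain (1 : Equiv.Perm (Fin N)) β = β := by ext; rfl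
    simp [this]
  · intro σ _ hσ
    rw [if_neg]
    intro h
    have hr : Set.range γ = Set.range β := by
      rw [h]
      ext n
      simp only [Set.mem_range, Finsupp.equivMapDomain_apply]
      exact (σ.symm.surjective.exists (p := fun y => β y = n)).symm
    have h2 := strictAnti_eq_of_range_eq hγ hβ hr
    apply hσ
    ext i
    have h3 := DFunLike.congr_fun h (σ i)
    rw [Finsupp.equivMapDomain_apply, Equiv.symm_apply_apply, h2] at h3
    simp [hβ.injective h3]
  · simp

/-- The exponent `δ = (N - 1, …, 1, 0)`. -/
noncomputable def staircase (N : ℕ) : Fin N →₀ ℕ :=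
  Finsupp.equivFunOnFinite.symm fun i => N - 1 - i

theorem staircase_apply (N : ℕ) (i : Fin N) : staircase N i = N - 1 - i := rfl

theorem strictAnti_staircase (N : ℕ) : StrictAnti (staircase N) := by
  intro i j hij
  rw [staircase_apply, staircase_apply]
  have := j.2
  have : (i : ℕ) < j := hij
  omega

theorem alternant_staircase_ne_zero (N : ℕ) : alternant (staircase N) ≠ 0 := by
  intro h
  have := coeff_alternant_strictAnti (strictAnti_staircase N) (strictAnti_staircase N)
  rw [h] at this
  simp at this

theorem renameEquiv_alternant {N : ℕ} (τ : Equiv.Perm (Fin N)) (β : Fin N →₀ ℕ) :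
    MvPowerSeries.renameEquiv ℂ τ (alternant β) =
      (Equiv.Perm.sign τ : ℤ) * alternant β := by
  rw [alternant, AlgEquiv.map_det, ← Matrix.det_permute]
  congr 1
  ext1 i j
  simp [MvPowerSeries.renameEquiv]

/-! ### Jacobi–Trudi determinants -/

/-- The determinant `det (h_{x_i + k})`, `1 ≤ i, k ≤ N`, of a sequence of integers (indexed from
`0`, as is `k` in the code). -/
noncomputable def jacobi (N : ℕ) (x : ℕ → ℤ) : SymFun :=
  (Matrix.of fun i k : Fin N => hSym (x i + k + 1)).det

theorem hSym_of_neg {r : ℤ} (hr : r < 0) : hSym r = 0 := by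
  classical
  apply Subtype.ext
  ext d
  rw [coeff_hSym, if_neg (by omega)]
  simp

theorem hSym_zero : hSym 0 = 1 := by
  classical
  apply Subtype.ext
  ext d
  rw [coeff_hSym]
  simp [MvPowerSeries.coeff_one, Finsupp.degree_eq_zero_iff]

theorem jacobi_congr {N : ℕ} {x y : ℕ → ℤ} (h : ∀ i < N, x i = y i) :
    jacobi N x = jacobi N y := by
  rw [jacobi, jacobi]
  congr 2
  ext i k
  rw [h i i.2]

theorem jacobi_eq_zero_of_lt {N : ℕ} {x : ℕ → ℤ} {i : ℕ} (hi : i < N) (h : x i < -N) :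
    jacobi N x = 0 := by
  refine Matrix.det_eq_zero_of_row_eq_zero ⟨i, hi⟩ fun k => ?_
  have := k.2
  exact hSym_of_neg (by simp only; omega)

theorem det_eq_of_last_row {R : Type*} [CommRing R] {N : ℕ}
    (A : Matrix (Fin (N + 1)) (Fin (N + 1)) R) (h0 : ∀ k : Fin N, A (Fin.last N) k.castSucc = 0)
    (h1 : A (Fin.last N) (Fin.last N) = 1) :
    A.det = (A.submatrix Fin.castSucc Fin.castSucc).det := by
  rw [Matrix.det_succ_row _ (Fin.last N), Fin.sum_univ_castSucc]
  simp [h0, h1, ← two_mul, pow_mul]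

theorem jacobi_succ {N : ℕ} {x : ℕ → ℤ} (h : x N = -((N : ℤ) + 1)) :
    jacobi (N + 1) x = jacobi N x := by
  rw [jacobi, det_eq_of_last_row]
  · rfl
  · intro k
    have := k.2
    simp only [Matrix.of_apply, Fin.val_last, h, Fin.val_castSucc]
    exact hSym_of_neg (by omega)
  · simp only [Matrix.of_apply, Fin.val_last, h]
    rw [show -((N : ℤ) + 1) + N + 1 = 0 by ring, hSym_zero]

theorem jacobi_of_le {N M : ℕ} (hNM : N ≤ M) {x : ℕ → ℤ}
    (h : ∀ i, N ≤ i → x i = -((i : ℤ) + 1)) : jacobi M x = jacobi N x := by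
  induction M, hNM using Nat.le_induction with
  | base => rfl
  | succ M hM ih => rw [jacobi_succ (h M hM), ih]

theorem MayaDiagram.seq_eq_of_length_le (x : MayaDiagram) {i : ℕ} (hi : x.length ≤ i) :
    x.seq i = -((i : ℤ) + 1) := by
  classical
  have := Nat.find_spec x.exists_part_eq_zero i hi
  rw [MayaDiagram.part] at this
  linarith

theorem schur_eq_jacobi (x : MayaDiagram) {N : ℕ} (hN : x.length ≤ N) :
    schur x = jacobi N x.seq := by
  rw [jacobi_of_le hN fun i hi => x.seq_eq_of_length_le hi, schur, jacobi]
  congr 2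
  ext i k
  rw [MayaDiagram.part]
  ring_nf

theorem X_pow_eq_sum_completeIn {N : ℕ} (i : Fin N) :
    ∃ c : ℕ → MvPowerSeries (Fin N) ℂ, ∀ r : ℕ, MvPowerSeries.X i ^ r =
      ∑ k ∈ Finset.range N, c k * completeIn 1 Finset.univ ((r : ℤ) - k) := by
  classical
  obtain ⟨c, -, hc⟩ := exists_completeIn_compl (Finset.univ.erase i)
  refine ⟨c, fun r => ?_⟩
  have h := hc r
  have hN : N - 1 + 1 = N := by have := i.2; omega
  have hS : (Finset.univ.erase i)ᶜ = {i} := by ext; simp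
  rw [Finset.card_erase_of_mem (Finset.mem_univ i), Finset.card_univ, Fintype.card_fin, hN, hS,
    completeIn_singleton] at h
  exact h

theorem det_finVars_jacobi {N : ℕ} (x : ℕ → ℤ) (M : ℕ) : finVars N (jacobi M x) =
    (Matrix.of fun i k : Fin M => completeIn 1 Finset.univ (x i + k + 1)).det := by
  rw [jacobi, AlgHom.map_det]
  congr 1
  ext1 i k
  exact finVars_hSym N _

/-- The sequence of integers which corresponds to an exponent in `N` variables: `β - N`, continued
by `-(N + 1), -(N + 2), …`. -/
def seqOfExponent {N : ℕ} (β : Fin N →₀ ℕ) (i : ℕ) : ℤ :=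
  if h : i < N then (β ⟨i, h⟩ : ℤ) - N else -((i : ℤ) + 1)

theorem seqOfExponent_coe {N : ℕ} (β : Fin N →₀ ℕ) (i : Fin N) :
    seqOfExponent β i = (β i : ℤ) - N := by
  simp [seqOfExponent]

theorem seqOfExponent_of_le {N : ℕ} (β : Fin N →₀ ℕ) {i : ℕ} (hi : N ≤ i) :
    seqOfExponent β i = -((i : ℤ) + 1) := by
  rw [seqOfExponent, dif_neg (by omega)]

/-- In `N` variables the Jacobi–Trudi determinant is a quotient of alternants. -/
theorem finVars_jacobi_mul_alternant {N : ℕ} (β : Fin N →₀ ℕ) :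
    finVars N (jacobi N (seqOfExponent β)) * alternant (staircase N) = alternant β := by
  choose c hc using fun i : Fin N => X_pow_eq_sum_completeIn i
  -- the matrix `C` does not depend on the exponent; its determinant is found at `δ`, where the
  -- Jacobi–Trudi determinant is `1`
  set C : Matrix (Fin N) (Fin N) (MvPowerSeries (Fin N) ℂ) :=
    Matrix.of fun k i => c i (N - 1 - k) with hC
  have key : ∀ γ : Fin N →₀ ℕ,
      finVars N (jacobi N (seqOfExponent γ)) * C.det = alternant γ := by
    intro γ
    rw [det_finVars_jacobi, ← Matrix.det_mul, alternant, ← Matrix.det_transpose]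
    congr 1
    ext1 i j
    rw [Matrix.transpose_apply, Matrix.of_apply, hc, Matrix.mul_apply,
      ← Fin.sum_univ_eq_sum_range
        (fun k => c i k * completeIn 1 Finset.univ (((γ j : ℕ) : ℤ) - k)),
      ← Equiv.sum_comp Fin.revPerm]
    refine Finset.sum_congr rfl fun k _ => ?_
    have hk := k.2
    simp only [hC, Matrix.of_apply, seqOfExponent_coe, Fin.revPerm_apply, Fin.val_rev]
    rw [mul_comm]
    congr 2
    · omega
    · omega
  have h1 : jacobi N (seqOfExponent (staircase N)) = 1 := by
    rw [jacobi_congr (y := fun i => -((i : ℤ) + 1))]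
    · rw [jacobi_of_le (Nat.zero_le N) fun i _ => rfl, jacobi, Matrix.det_isEmpty]
    · intro i hi
      rw [seqOfExponent, dif_pos hi, staircase_apply]
      simp only
      omega
  have h2 := key (staircase N)
  rw [h1, map_one, one_mul] at h2
  rw [← h2, key]

/-- A Schur function with more than `N` parts vanishes in `N` variables: there the `h_r`, `r > 0`,
satisfy a linear recurrence of order `N`, so the columns are linearly dependent. -/
theorem finVars_jacobi_eq_zero {N M : ℕ} (hNM : N < M) {x : ℕ → ℤ}
    (hx : ∀ i < M, 0 < x i + M) : finVars N (jacobi M x) = 0 := by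
  obtain ⟨c, hc0, hc⟩ := exists_completeIn_compl (Finset.univ : Finset (Fin N))
  have : IsDomain (MvPowerSeries (Fin N) ℂ) := NoZeroDivisors.to_isDomain _
  rw [det_finVars_jacobi, ← Matrix.exists_mulVec_eq_zero_iff]
  refine ⟨fun k => if M - 1 - (k : ℕ) < N + 1 then c (M - 1 - k) else 0, ?_, ?_⟩
  · intro h
    have := congrFun h ⟨M - 1, by omega⟩
    simp [hc0] at this
  · ext1 i
    have h := hc (x i + M)
    rw [Finset.compl_univ, completeIn_empty le_rfl, if_neg (hx i i.2).ne', Finset.card_univ,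
      Fintype.card_fin] at h
    rw [Matrix.mulVec, dotProduct, ← Equiv.sum_comp Fin.revPerm]
    refine Eq.trans ?_ h.symm
    have h3 : ∀ k ∈ Finset.range (N + 1), c k * completeIn 1 Finset.univ (x i + M - k) =
        (if k < N + 1 then c k else 0) * completeIn 1 Finset.univ (x i + M - k) := by
      intro k hk
      rw [if_pos (Finset.mem_range.1 hk)]
    rw [Finset.sum_congr rfl h3, Finset.sum_subset (Finset.range_mono (show N + 1 ≤ M by omega)),
      ← Fin.sum_univ_eq_sum_range
        (fun k => (if k < N + 1 then c k else 0) * completeIn 1 Finset.univ (x i + M - k))]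
    · refine Finset.sum_congr rfl fun k _ => ?_
      have hk := k.2
      simp only [Matrix.of_apply, Fin.revPerm_apply, Fin.val_rev]
      have h4 : M - 1 - (M - (k + 1)) = (k : ℕ) := by omega
      have h5 : x i + ((M - (k + 1) : ℕ) : ℤ) + 1 = x i + M - k := by omega
      rw [h4, h5, mul_comm]
    · intro k _ hk
      rw [if_neg (by simpa using hk), zero_mul]

/-! ### The Schur function of a sequence -/

theorem MayaDiagram.ext_seq {x y : MayaDiagram} (h : x.seq = y.seq) : x = y := by
  cases x; cases y; simp_all

theorem bracket_eq_single {x : ℕ → ℤ} (hx : Function.Injective x) (y : MayaDiagram)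
    (hy : Set.range y.seq = Set.range x) :
    bracket x = Finsupp.single y ((-1 : ℂ) ^ seqInversions x) := by
  have h : Function.Injective x ∧ ∃ y : MayaDiagram, Set.range y.seq = Set.range x := ⟨hx, y, hy⟩
  rw [bracket, dif_pos h]
  congr 1
  exact MayaDiagram.ext_seq (strictAnti_eq_of_range_eq h.2.choose.strictAnti y.strictAnti
    (h.2.choose_spec.trans hy.symm))

/-- The maya diagram of a strictly decreasing exponent in `N` variables. -/
def MayaDiagram.ofExponent {N : ℕ} (γ : Fin N →₀ ℕ) (hγ : StrictAnti γ) : MayaDiagram where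
  seq := seqOfExponent γ
  strictAnti := by
    intro i j hij
    by_cases hj : j < N
    · have h := hγ (show (⟨i, by omega⟩ : Fin N) < ⟨j, hj⟩ from hij)
      rw [seqOfExponent, seqOfExponent, dif_pos hj, dif_pos (by omega)]
      omega
    · rw [seqOfExponent_of_le γ (i := j) (by omega), seqOfExponent]
      split_ifs <;> omega
  eventually_eq := ⟨N, fun _ hi => seqOfExponent_of_le γ hi⟩

theorem MayaDiagram.seq_ofExponent {N : ℕ} (γ : Fin N →₀ ℕ) (hγ : StrictAnti γ) :
    (MayaDiagram.ofExponent γ hγ).seq = seqOfExponent γ := rfl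

theorem MayaDiagram.length_ofExponent_le {N : ℕ} (γ : Fin N →₀ ℕ) (hγ : StrictAnti γ) :
    (MayaDiagram.ofExponent γ hγ).length ≤ N := by
  classical
  refine Nat.find_min' _ fun i hi => ?_
  rw [MayaDiagram.part, MayaDiagram.seq_ofExponent, seqOfExponent_of_le γ hi]
  ring

theorem schurMap_single (x : MayaDiagram) (c : ℂ) :
    schurMap (Finsupp.single x c) = c • schur x :=
  Finsupp.linearCombination_single ℂ c x

theorem exists_strictAnti_comp_perm {N : ℕ} {β : Fin N →₀ ℕ} (hβ : Function.Injective β) :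
    ∃ (τ : Equiv.Perm (Fin N)) (γ : Fin N →₀ ℕ), StrictAnti γ ∧ ∀ i, β i = γ (τ i) := by
  set σ := Tuple.sort (OrderDual.toDual ∘ β) with hσ
  refine ⟨σ⁻¹, Finsupp.equivFunOnFinite.symm (β ∘ σ), ?_, fun i => ?_⟩
  · have h1 : Antitone (β ∘ σ) := Tuple.monotone_sort (OrderDual.toDual ∘ β)
    exact h1.strictAnti_of_injective (hβ.comp σ.injective)
  · simp [Equiv.Perm.inv_def]

theorem jacobi_eq_zero_of_not_injective {N : ℕ} {x : ℕ → ℤ} {i j : ℕ} (hi : i < N) (hj : j < N)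
    (hij : i ≠ j) (h : x i = x j) : jacobi N x = 0 := by
  refine Matrix.det_zero_of_row_eq (i := ⟨i, hi⟩) (j := ⟨j, hj⟩) (by simpa using hij) ?_
  ext1 k
  simp [h]

theorem jacobi_eq_sign_smul {N : ℕ} {β γ : Fin N →₀ ℕ} (hγ : StrictAnti γ)
    (τ : Equiv.Perm (Fin N)) (h : ∀ i, β i = γ (τ i)) :
    jacobi N (seqOfExponent β) = ((Equiv.Perm.sign τ : ℤ) : ℂ) •
      schur (MayaDiagram.ofExponent γ hγ) := by
  rw [schur_eq_jacobi _ (MayaDiagram.length_ofExponent_le γ hγ), Int.cast_smul_eq_zsmul,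
    zsmul_eq_mul, jacobi, jacobi, ← Matrix.det_permute]
  congr 1
  ext1 i k
  simp [MayaDiagram.ofExponent, seqOfExponent_coe, h]

theorem seqInversions_eq_card {N : ℕ} (β : Fin N →₀ ℕ) :
    seqInversions (seqOfExponent β) =
      (Finset.univ.filter fun p : Fin N × Fin N => p.1 < p.2 ∧ β p.1 < β p.2).card := by
  classical
  rw [seqInversions, ← Set.ncard_coe_finset, ← Set.ncard_image_of_injective _
    ((Fin.val_injective (n := N)).prodMap (Fin.val_injective (n := N)))]
  congr 1
  ext ⟨i, j⟩
  simp only [Set.mem_ofPred_eq, Set.mem_image, Finset.coe_filter, Finset.mem_univ, true_and,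
    Prod.exists, Prod.map_apply, Prod.mk.injEq]
  constructor
  · rintro ⟨h1, h2⟩
    have hj : j < N := by
      by_contra hj
      rw [seqOfExponent_of_le β (i := j) (by omega), seqOfExponent] at h2
      split_ifs at h2 <;> omega
    rw [seqOfExponent, seqOfExponent, dif_pos hj, dif_pos (by omega)] at h2
    exact ⟨⟨i, by omega⟩, ⟨j, hj⟩, ⟨h1, by omega⟩, rfl, rfl⟩
  · rintro ⟨a, b, ⟨h1, h2⟩, rfl, rfl⟩
    rw [seqOfExponent_coe, seqOfExponent_coe]
    exact ⟨h1, by omega⟩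

theorem sign_eq_pow_seqInversions {N : ℕ} {β γ : Fin N →₀ ℕ} (hγ : StrictAnti γ)
    (τ : Equiv.Perm (Fin N)) (h : ∀ i, β i = γ (τ i)) :
    (Equiv.Perm.sign τ : ℤ) = (-1) ^ seqInversions (seqOfExponent β) := by
  classical
  rw [seqInversions_eq_card, Equiv.Perm.sign_eq_prod_prod_Ioi, Units.coe_prod]
  simp only [Units.coe_prod]
  rw [Finset.prod_sigma', ← Finset.prod_const, Finset.prod_filter,
    ← Finset.prod_subset (Finset.subset_univ
      (Finset.univ.filter fun p : Fin N × Fin N => p.1 < p.2))]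
  · refine Finset.prod_bij' (fun p _ => (p.1, p.2)) (fun p _ => ⟨p.1, p.2⟩) ?_ ?_ ?_ ?_ ?_
    · simp
    · simp
    · simp
    · simp
    · rintro ⟨i, j⟩ hij
      have hij : i < j := by simpa using hij
      simp only [hij, true_and, h, hγ.lt_iff_gt]
      have := τ.injective.ne hij.ne
      split_ifs <;> first | rfl | (exfalso; omega)
  · intro p _ hp
    rw [if_neg]
    simp only [Finset.mem_filter, Finset.mem_univ, true_and] at hp
    exact fun h' => hp h'.1

/-- The map `F → Λ` sends the element `[x₁, x₂, …]` of `F`, for a sequence which need not be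
decreasing, to the Jacobi–Trudi determinant of the sequence. -/
theorem schurMap_bracket {N : ℕ} {x : ℕ → ℤ} (hx : ∀ i, N ≤ i → x i = -((i : ℤ) + 1)) :
    schurMap (bracket x) = jacobi N x := by
  by_cases hlow : ∃ i < N, x i < -N
  -- an entry below `-N` occurs again in the tail of the sequence
  · obtain ⟨i, hi, h⟩ := hlow
    rw [jacobi_eq_zero_of_lt hi h, bracket, dif_neg, map_zero]
    rintro ⟨hinj, -⟩
    have h1 := hx (-x i - 1).toNat (by omega)
    have h2 : i = (-x i - 1).toNat := hinj (by omega)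
    omega
  push Not at hlow
  obtain ⟨β, hβ⟩ : ∃ β : Fin N →₀ ℕ, x = seqOfExponent β := by
    refine ⟨Finsupp.equivFunOnFinite.symm fun i => (x i + N).toNat, ?_⟩
    ext i
    rw [seqOfExponent]
    split_ifs with hi
    · have := hlow i hi
      simp only [Finsupp.equivFunOnFinite_symm_apply_apply]
      omega
    · exact hx i (by omega)
  subst hβ
  by_cases hinj : Function.Injective β
  · obtain ⟨τ, γ, hγ, h⟩ := exists_strictAnti_comp_perm hinj
    have hcomp : ∀ i : ℕ, ∃ j : ℕ, seqOfExponent β i = seqOfExponent γ j := fun i => by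
      by_cases hi : i < N
      · exact ⟨τ ⟨i, hi⟩, by
          have := seqOfExponent_coe β ⟨i, hi⟩
          rw [seqOfExponent_coe, ← h]; exact this⟩
      · exact ⟨i, by rw [seqOfExponent_of_le _ (by omega), seqOfExponent_of_le _ (by omega)]⟩
    have hcomp' : ∀ i : ℕ, ∃ j : ℕ, seqOfExponent γ i = seqOfExponent β j := fun i => by
      by_cases hi : i < N
      · exact ⟨τ.symm ⟨i, hi⟩, by
          have := seqOfExponent_coe γ ⟨i, hi⟩
          rw [seqOfExponent_coe, h, Equiv.apply_symm_apply]; exact this⟩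
      · exact ⟨i, by rw [seqOfExponent_of_le _ (by omega), seqOfExponent_of_le _ (by omega)]⟩
    have hinj' : Function.Injective (seqOfExponent β) := by
      intro i j hij
      rw [seqOfExponent, seqOfExponent] at hij
      split_ifs at hij with h1 h2
      · have := hinj (show β ⟨i, h1⟩ = β ⟨j, h2⟩ by omega)
        simpa using this
      all_goals omega
    rw [bracket_eq_single hinj' (MayaDiagram.ofExponent γ hγ), schurMap_single,
      jacobi_eq_sign_smul hγ τ h, sign_eq_pow_seqInversions hγ τ h]
    · push_cast
      rfl
    · apply Set.Subset.antisymm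
      · rintro _ ⟨i, rfl⟩
        obtain ⟨j, hj⟩ := hcomp' i
        exact ⟨j, hj.symm⟩
      · rintro _ ⟨i, rfl⟩
        obtain ⟨j, hj⟩ := hcomp i
        exact ⟨j, hj.symm⟩
  · simp only [Function.Injective, not_forall] at hinj
    obtain ⟨i, j, h, hij⟩ := hinj
    have hne : (i : ℕ) ≠ j := fun h' => hij (Fin.ext h')
    have heq : seqOfExponent β i = seqOfExponent β j := by
      rw [seqOfExponent_coe, seqOfExponent_coe, h]
    rw [jacobi_eq_zero_of_not_injective i.2 j.2 hne heq, bracket,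
      dif_neg fun h' => hne (h'.1 heq), map_zero]

/-! ### The Schur functions are linearly independent -/

/-- The exponent `x + N` in `N` variables of a maya diagram `x`; it determines `x` if the length is
at most `N`. -/
noncomputable def MayaDiagram.exponent (x : MayaDiagram) (N : ℕ) : Fin N →₀ ℕ :=
  Finsupp.equivFunOnFinite.symm fun i => (x.seq i + N).toNat

theorem MayaDiagram.neg_le_seq (x : MayaDiagram) {N i : ℕ} (hN : x.length ≤ N) (hi : i < N) :
    -(N : ℤ) ≤ x.seq i := by
  have h1 := x.strictAnti hi
  rw [x.seq_eq_of_length_le hN] at h1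
  omega

theorem MayaDiagram.seqOfExponent_exponent (x : MayaDiagram) {N : ℕ} (hN : x.length ≤ N) :
    seqOfExponent (x.exponent N) = x.seq := by
  ext i
  rw [seqOfExponent]
  split_ifs with hi
  · have := x.neg_le_seq hN hi
    simp only [MayaDiagram.exponent, Finsupp.equivFunOnFinite_symm_apply_apply]
    omega
  · exact (x.seq_eq_of_length_le (by omega)).symm

theorem MayaDiagram.coe_exponent (x : MayaDiagram) {N : ℕ} (hN : x.length ≤ N) (i : Fin N) :
    (x.exponent N i : ℤ) = x.seq i + N := by
  have := congrFun (x.seqOfExponent_exponent hN) i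
  rw [seqOfExponent_coe] at this
  omega

theorem MayaDiagram.strictAnti_exponent (x : MayaDiagram) {N : ℕ} (hN : x.length ≤ N) :
    StrictAnti (x.exponent N) := by
  intro i j hij
  have h1 := x.coe_exponent hN i
  have h2 := x.coe_exponent hN j
  have h3 := x.strictAnti (show (i : ℕ) < j from hij)
  omega

theorem MayaDiagram.exponent_inj {x y : MayaDiagram} {N : ℕ} (hx : x.length ≤ N)
    (hy : y.length ≤ N) : x.exponent N = y.exponent N ↔ x = y := by
  refine ⟨fun h => MayaDiagram.ext_seq ?_, fun h => h ▸ rfl⟩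
  rw [← x.seqOfExponent_exponent hx, h, y.seqOfExponent_exponent hy]

theorem MayaDiagram.neg_length_lt_seq (y : MayaDiagram) {i : ℕ} (hi : i < y.length) :
    -(y.length : ℤ) < y.seq i := by
  classical
  obtain ⟨M, hM⟩ : ∃ M, y.length = M + 1 := ⟨y.length - 1, by omega⟩
  have h1 : -((M : ℤ) + 1) < y.seq M := by
    refine lt_of_le_of_ne ?_ fun h => ?_
    · have := y.neg_le_seq le_rfl (show M < y.length by omega)
      omega
    · refine Nat.find_min y.exists_part_eq_zero (m := M) (show M < y.length by omega)
        fun j hj => ?_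
      rcases hj.eq_or_lt with rfl | hj
      · rw [MayaDiagram.part, ← h]; ring
      · rw [MayaDiagram.part, y.seq_eq_of_length_le (by omega)]; ring
  have h2 := y.strictAnti.antitone (show i ≤ M by omega)
  omega

theorem finVars_schur_eq_zero {N : ℕ} {y : MayaDiagram} (h : N < y.length) :
    finVars N (schur y) = 0 := by
  rw [schur_eq_jacobi y le_rfl]
  refine finVars_jacobi_eq_zero h fun i hi => ?_
  have := y.neg_length_lt_seq hi
  omega

theorem finVars_schur_mul_alternant {N : ℕ} {y : MayaDiagram} (h : y.length ≤ N) :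
    finVars N (schur y) * alternant (staircase N) = alternant (y.exponent N) := by
  rw [schur_eq_jacobi y h, ← y.seqOfExponent_exponent h, finVars_jacobi_mul_alternant]

/-- The coefficient of the Schur function of `x` in a symmetric function `f`, computed in `N`
variables as the coefficient of `X^{x + N}` in `f a_δ`. -/
noncomputable def schurCoeff (N : ℕ) (x : MayaDiagram) : SymFun →ₗ[ℂ] ℂ :=
  MvPowerSeries.coeff (x.exponent N) ∘ₗ LinearMap.mulRight ℂ (alternant (staircase N)) ∘ₗ
    (finVars N).toLinearMap

theorem schurCoeff_apply (N : ℕ) (x : MayaDiagram) (f : SymFun) : schurCoeff N x f =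
    MvPowerSeries.coeff (x.exponent N) (finVars N f * alternant (staircase N)) := rfl

theorem schurCoeff_schur {N : ℕ} {x : MayaDiagram} (hx : x.length ≤ N) (y : MayaDiagram) :
    schurCoeff N x (schur y) = Finsupp.single y (1 : ℂ) x := by
  classical
  rw [schurCoeff_apply, Finsupp.single_apply]
  by_cases hy : y.length ≤ N
  · rw [finVars_schur_mul_alternant hy,
      coeff_alternant_strictAnti (y.strictAnti_exponent hy) (x.strictAnti_exponent hx)]
    simp only [MayaDiagram.exponent_inj hx hy, eq_comm]
  · rw [finVars_schur_eq_zero (by omega), zero_mul, map_zero, if_neg]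
    rintro rfl
    exact hy hx

theorem schurCoeff_schurMap {N : ℕ} {x : MayaDiagram} (hx : x.length ≤ N) (v : FockSpace) :
    schurCoeff N x (schurMap v) = v x := by
  induction v using Finsupp.induction_linear with
  | zero => simp
  | add u v hu hv => rw [map_add, map_add, hu, hv, Finsupp.add_apply]
  | single y c =>
    rw [schurMap_single, map_smul, schurCoeff_schur hx, ← Finsupp.smul_apply,
      Finsupp.smul_single_one]

theorem injective_schurMap : Function.Injective schurMap := by
  intro u v h
  ext x
  rw [← schurCoeff_schurMap le_rfl, h, schurCoeff_schurMap le_rfl]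

/-! ### The Schur functions span -/

theorem coeff_equivMapDomain_renameEquiv {σ : Type*} (τ : Equiv.Perm σ) (f : MvPowerSeries σ ℂ)
    (d : σ →₀ ℕ) : MvPowerSeries.coeff (Finsupp.equivMapDomain τ d)
      (MvPowerSeries.renameEquiv ℂ τ f) = MvPowerSeries.coeff d f := by
  have h := MvPowerSeries.coeff_embDomain_rename (R := ℂ) τ.toEmbedding f d
  rw [Finsupp.embDomain_eq_mapDomain] at h
  rw [Finsupp.equivMapDomain_eq_mapDomain]
  exact h

theorem coeff_equivMapDomain_symFun (f : SymFun) (σ : Equiv.Perm ℕ) (d : ℕ →₀ ℕ) :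
    MvPowerSeries.coeff (Finsupp.equivMapDomain σ d) f.1 = MvPowerSeries.coeff d f.1 := by
  conv_lhs => rw [← f.2.1 σ]
  exact coeff_equivMapDomain_renameEquiv σ f.1 d

theorem renameEquiv_finVars {N : ℕ} (f : SymFun) (τ : Equiv.Perm (Fin N)) :
    MvPowerSeries.renameEquiv ℂ τ (finVars N f) = finVars N f := by
  ext d
  obtain ⟨e, rfl⟩ := (Finsupp.equivCongrLeft (M := ℕ) τ).surjective d
  rw [Finsupp.equivCongrLeft_apply, coeff_equivMapDomain_renameEquiv, coeff_finVars,
    coeff_finVars, ← coeff_equivMapDomain_symFun f (τ.viaFintypeEmbedding Fin.valEmbedding)]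
  congr 2
  ext i
  rw [Finsupp.equivMapDomain_apply]
  obtain ⟨j, rfl⟩ := (τ.viaFintypeEmbedding Fin.valEmbedding).surjective i
  rw [Equiv.symm_apply_apply]
  by_cases hj : j ∈ Set.range (Fin.valEmbedding (n := N))
  · obtain ⟨k, rfl⟩ := hj
    rw [Equiv.Perm.viaFintypeEmbedding_apply_image, Finsupp.embDomain_apply_self,
      Finsupp.embDomain_apply_self, Finsupp.equivMapDomain_apply, Equiv.symm_apply_apply]
  · rw [Equiv.Perm.viaFintypeEmbedding_apply_notMem_range _ _ hj,
      Finsupp.embDomain_of_notMem_range _ _ _ hj, Finsupp.embDomain_of_notMem_range _ _ _ hj]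

/-- An antisymmetric power series is determined by its coefficients at the strictly decreasing
exponents. -/
theorem antisymm_eq_zero {N : ℕ} {G : MvPowerSeries (Fin N) ℂ}
    (hG : ∀ τ : Equiv.Perm (Fin N),
      MvPowerSeries.renameEquiv ℂ τ G = (Equiv.Perm.sign τ : ℤ) * G)
    (h0 : ∀ γ : Fin N →₀ ℕ, StrictAnti γ → MvPowerSeries.coeff γ G = 0) : G = 0 := by
  have key : ∀ (τ : Equiv.Perm (Fin N)) (d : Fin N →₀ ℕ),
      ((Equiv.Perm.sign τ : ℤ) : ℂ) * MvPowerSeries.coeff (Finsupp.equivMapDomain τ d) G =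
        MvPowerSeries.coeff d G := by
    intro τ d
    conv_rhs => rw [← coeff_equivMapDomain_renameEquiv τ, hG, ← zsmul_eq_mul, map_zsmul]
    rw [zsmul_eq_mul]
  ext d
  rw [map_zero]
  by_cases hd : Function.Injective d
  · obtain ⟨τ, γ, hγ, h⟩ := exists_strictAnti_comp_perm hd
    have : Finsupp.equivMapDomain τ d = γ := by
      ext i
      rw [Finsupp.equivMapDomain_apply, h, Equiv.apply_symm_apply]
    rw [← key τ, this, h0 γ hγ, mul_zero]
  · simp only [Function.Injective, not_forall] at hd
    obtain ⟨i, j, h, hij⟩ := hd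
    have h1 := key (Equiv.swap i j) d
    -- the exponent has a repeated entry, so a transposition fixes it
    have h2 : Finsupp.equivMapDomain (Equiv.swap i j) d = d := by
      ext k
      rw [Finsupp.equivMapDomain_apply, Equiv.symm_swap]
      by_cases hi : k = i
      · subst hi; rw [Equiv.swap_apply_left, h]
      · by_cases hj : k = j
        · subst hj; rw [Equiv.swap_apply_right, h]
        · rw [Equiv.swap_apply_of_ne_of_ne hi hj]
    rw [h2, Equiv.Perm.sign_swap hij] at h1
    simp only [Units.val_neg, Units.val_one, Int.cast_neg, Int.cast_one, neg_mul, one_mul] at h1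
    exact self_eq_neg.1 h1.symm

theorem exists_perm_embDomain_fin {N : ℕ} (d : ℕ →₀ ℕ) (hd : d.degree ≤ N) :
    ∃ (σ : Equiv.Perm ℕ) (e : Fin N →₀ ℕ),
      Finsupp.embDomain Fin.valEmbedding e = Finsupp.equivMapDomain σ d := by
  classical
  have hcard : d.support.card ≤ N := by
    refine le_trans ?_ hd
    rw [Finsupp.degree_apply, Finset.card_eq_sum_ones]
    refine Finset.sum_le_sum fun i hi => ?_
    have := Finsupp.mem_support_iff.1 hi
    omega
  have e1 : {i // i ∈ d.support} ≃ {i // i ∈ Finset.range d.support.card} :=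
    Finset.equivOfCardEq (by simp)
  have hinf : ∀ s : Finset ℕ, Infinite {i // i ∉ s} := fun s =>
    (Set.Finite.infinite_compl s.finite_toSet).to_subtype
  have := hinf d.support
  have := hinf (Finset.range d.support.card)
  obtain ⟨e2⟩ := nonempty_equiv_of_countable (α := {i // i ∉ d.support})
    (β := {i // i ∉ Finset.range d.support.card})
  set σ := Equiv.subtypeCongr e1 e2 with hσ
  refine ⟨σ, (Finsupp.equivMapDomain σ d).comapDomain _ Fin.valEmbedding.injective.injOn,
    Finsupp.embDomain_comapDomain fun i hi => ?_⟩
  have hi' : σ.symm i ∈ d.support := by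
    simpa using hi
  have h1 : ∀ (j : ℕ) (hj : j ∈ d.support), σ j = e1 ⟨j, hj⟩ := fun j hj => by
    simp [hσ, Equiv.subtypeCongr, Equiv.sumCompl_symm_apply_of_pos hj]
  have h2 := h1 _ hi'
  rw [Equiv.apply_symm_apply] at h2
  have h3 := (e1 ⟨σ.symm i, hi'⟩).2
  rw [← h2, Finset.mem_range] at h3
  exact ⟨⟨i, by omega⟩, rfl⟩

/-- A symmetric function of degree at most `N` is determined by its restriction to `N`
variables. -/
theorem eq_zero_of_finVars_eq_zero {N : ℕ} {f : SymFun} (h : finVars N f = 0)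
    (hf : ∀ d : ℕ →₀ ℕ, N < d.degree → MvPowerSeries.coeff d f.1 = 0) : f = 0 := by
  apply Subtype.ext
  ext d
  rcases lt_or_ge N d.degree with hd | hd
  · rw [hf d hd]; simp
  · obtain ⟨σ, e, he⟩ := exists_perm_embDomain_fin d hd
    rw [← coeff_equivMapDomain_symFun f σ, ← he, ← coeff_finVars, h]
    simp

theorem coeff_prod_eq_zero {ι : Type*} (s : Finset ι) (g : ι → MvPowerSeries ℕ ℂ) (r : ι → ℤ)
    (hg : ∀ i ∈ s, ∀ d : ℕ →₀ ℕ, (d.degree : ℤ) ≠ r i → MvPowerSeries.coeff d (g i) = 0)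
    (d : ℕ →₀ ℕ) (hd : (d.degree : ℤ) ≠ ∑ i ∈ s, r i) :
    MvPowerSeries.coeff d (∏ i ∈ s, g i) = 0 := by
  classical
  rw [MvPowerSeries.coeff_prod]
  refine Finset.sum_eq_zero fun l hl => ?_
  rw [Finset.mem_finsuppAntidiag] at hl
  by_contra hne
  rw [← ne_eq, Finset.prod_ne_zero_iff] at hne
  apply hd
  rw [← hl.1, map_sum]
  push_cast
  refine Finset.sum_congr rfl fun i hi => ?_
  by_contra h
  exact hne i hi (hg i hi _ h)

theorem coeff_jacobi_eq_zero {N : ℕ} {x : ℕ → ℤ} {d : ℕ →₀ ℕ}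
    (hd : (d.degree : ℤ) ≠ ∑ i : Fin N, (x i + i + 1)) :
    MvPowerSeries.coeff d (jacobi N x).1 = 0 := by
  classical
  have h : (jacobi N x).1 =
      (Matrix.of fun i k : Fin N => (hSym (x i + k + 1)).1).det := by
    rw [jacobi]
    exact SymFun.val.map_det _
  rw [h, Matrix.det_apply', map_sum]
  refine Finset.sum_eq_zero fun σ _ => ?_
  rw [← zsmul_eq_mul, map_zsmul, coeff_prod_eq_zero _ _ (fun i => x (σ i) + i + 1), smul_zero]
  · intro i _ e he
    rw [Matrix.of_apply, coeff_hSym, if_neg he]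
  · refine fun h => hd (h.trans ?_)
    simp only [Finset.sum_add_distrib]
    rw [Equiv.sum_comp σ fun i : Fin N => x i]

theorem surjective_schurMap : Function.Surjective schurMap := by
  classical
  intro f
  obtain ⟨N, hN⟩ := f.2.2
  set K := N + (staircase N).degree with hK
  set B : Finset (Fin N →₀ ℕ) :=
    (Finsupp.finite_of_degree_le (σ := Fin N) K).toFinset.filter fun β => StrictAnti β with hB
  set g := finVars N f * alternant (staircase N) with hg
  -- the products with `f` and with the Schur functions have the same coefficients at the strictly
  -- decreasing exponents
  have h1 : f - ∑ β ∈ B, MvPowerSeries.coeff β g • jacobi N (seqOfExponent β) = 0 := by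
    apply eq_zero_of_finVars_eq_zero (N := N)
    · refine (mul_eq_zero_iff_right (alternant_staircase_ne_zero N)).1 ?_
      have h2 : finVars N (f - ∑ β ∈ B, MvPowerSeries.coeff β g • jacobi N (seqOfExponent β)) *
          alternant (staircase N) = g - ∑ β ∈ B, MvPowerSeries.coeff β g • alternant β := by
        rw [map_sub, map_sum, sub_mul, Finset.sum_mul]
        congr 1
        refine Finset.sum_congr rfl fun β _ => ?_
        rw [map_smul, smul_mul_assoc, finVars_jacobi_mul_alternant]
      apply antisymm_eq_zero
      · intro τ
        rw [map_mul, renameEquiv_finVars, renameEquiv_alternant]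
        ring
      · intro γ hγ
        rw [h2, map_sub, map_sum]
        simp only [map_smul, smul_eq_mul]
        have h3 : ∀ β ∈ B, MvPowerSeries.coeff β g * MvPowerSeries.coeff γ (alternant β) =
            if γ = β then MvPowerSeries.coeff β g else 0 := by
          intro β hβ
          rw [coeff_alternant_strictAnti (Finset.mem_filter.1 hβ).2 hγ]
          split_ifs <;> simp
        rw [Finset.sum_congr rfl h3, Finset.sum_ite_eq]
        split_ifs with hγB
        · rw [sub_self]
        · rw [sub_zero, hg, MvPowerSeries.coeff_mul]
          refine Finset.sum_eq_zero fun p hp => ?_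
          have h4 : K < γ.degree := by
            by_contra h
            exact hγB (Finset.mem_filter.2 ⟨by simpa using h, hγ⟩)
          have h5 : p.1.degree + p.2.degree = γ.degree := by
            rw [← map_add, Finset.HasAntidiagonal.mem_antidiagonal.1 hp]
          by_cases h6 : N < p.1.degree
          · rw [coeff_finVars, hN _ (by rwa [degree_embDomain]), zero_mul]
          · rw [coeff_alternant, Finset.sum_eq_zero, mul_zero]
            intro σ _
            rw [if_neg]
            intro h7
            have h8 : p.2.degree = (staircase N).degree := by
              rw [h7, Finsupp.degree_eq_sum, Finsupp.degree_eq_sum]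
              simp only [Finsupp.equivMapDomain_apply]
              exact Equiv.sum_comp σ.symm _
            omega
    · intro d hd
      have h2 : ∀ β ∈ B, MvPowerSeries.coeff d (jacobi N (seqOfExponent β)).1 = 0 := by
        intro β hβ
        apply coeff_jacobi_eq_zero
        have h3 : β.degree ≤ K := by simpa using (Finset.mem_filter.1 hβ).1
        have h4 : ∑ i : Fin N, (seqOfExponent β i + i + 1) =
            (β.degree : ℤ) - (staircase N).degree := by
          rw [Finsupp.degree_eq_sum, Finsupp.degree_eq_sum]
          push_cast
          rw [← Finset.sum_sub_distrib]
          refine Finset.sum_congr rfl fun i _ => ?_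
          rw [seqOfExponent_coe, staircase_apply]
          have := i.2
          omega
        rw [h4]
        omega
      have h3 : (f - ∑ β ∈ B, MvPowerSeries.coeff β g • jacobi N (seqOfExponent β)).1 =
          f.1 - ∑ β ∈ B, MvPowerSeries.coeff β g • (jacobi N (seqOfExponent β)).1 := by
        simp
      rw [h3, map_sub, hN d hd, map_sum, Finset.sum_eq_zero, sub_zero]
      intro β hβ
      rw [map_smul, h2 β hβ, smul_zero]
  rw [sub_eq_zero] at h1
  refine ⟨∑ β ∈ B, MvPowerSeries.coeff β g • bracket (seqOfExponent β), ?_⟩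
  rw [map_sum, h1]
  refine Finset.sum_congr rfl fun β _ => ?_
  rw [map_smul, schurMap_bracket fun i hi => seqOfExponent_of_le β hi]

theorem bijective_schurMap : Function.Bijective schurMap :=
  ⟨injective_schurMap, surjective_schurMap⟩

/-! ### The Hall inner product and the adjoints of multiplications -/

theorem invFun_schurMap (v : FockSpace) : Function.invFun schurMap (schurMap v) = v :=
  Function.leftInverse_invFun injective_schurMap v

theorem hallInner_schurMap (u v : FockSpace) :
    hallInner (schurMap u) (schurMap v) = u.sum fun x c => c * v x := by
  rw [hallInner, invFun_schurMap, invFun_schurMap]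

theorem hallInner_comm (f g : SymFun) : hallInner f g = hallInner g f := by
  classical
  obtain ⟨u, rfl⟩ := surjective_schurMap f
  obtain ⟨v, rfl⟩ := surjective_schurMap g
  rw [hallInner_schurMap, hallInner_schurMap,
    Finsupp.sum_of_support_subset u (s := u.support ∪ v.support) Finset.subset_union_left
      (fun x c => c * v x) (fun _ _ => zero_mul _),
    Finsupp.sum_of_support_subset v (s := u.support ∪ v.support) Finset.subset_union_right
      (fun x c => c * u x) (fun _ _ => zero_mul _)]
  exact Finset.sum_congr rfl fun x _ => mul_comm _ _

theorem hallInner_schur {N : ℕ} {x : MayaDiagram} (hx : x.length ≤ N) (g : SymFun) :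
    hallInner (schur x) g = schurCoeff N x g := by
  obtain ⟨v, rfl⟩ := surjective_schurMap g
  rw [schurCoeff_schurMap hx, ← one_smul ℂ (schur x), ← schurMap_single, hallInner_schurMap,
    Finsupp.sum_single_index (zero_mul _), one_mul]

theorem hallInner_add_left (f g k : SymFun) :
    hallInner (f + g) k = hallInner f k + hallInner g k := by
  obtain ⟨u, rfl⟩ := surjective_schurMap f
  obtain ⟨v, rfl⟩ := surjective_schurMap g
  obtain ⟨w, rfl⟩ := surjective_schurMap k
  rw [← map_add, hallInner_schurMap, hallInner_schurMap, hallInner_schurMap]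
  exact Finsupp.sum_add_index' (fun _ => zero_mul _) fun _ _ _ => add_mul _ _ _

theorem hallInner_smul_left (c : ℂ) (f k : SymFun) :
    hallInner (c • f) k = c * hallInner f k := by
  obtain ⟨u, rfl⟩ := surjective_schurMap f
  obtain ⟨w, rfl⟩ := surjective_schurMap k
  rw [← map_smul, hallInner_schurMap, hallInner_schurMap,
    Finsupp.sum_smul_index' fun _ => zero_mul _, Finsupp.mul_sum]
  simp only [smul_eq_mul, mul_assoc]

theorem hallInner_add_right (f g k : SymFun) :
    hallInner k (f + g) = hallInner k f + hallInner k g := by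
  rw [hallInner_comm, hallInner_add_left, hallInner_comm f, hallInner_comm g]

theorem hallInner_smul_right (c : ℂ) (f k : SymFun) :
    hallInner k (c • f) = c * hallInner k f := by
  rw [hallInner_comm, hallInner_smul_left, hallInner_comm f]

theorem hallInner_zero_left (k : SymFun) : hallInner 0 k = 0 := by
  simpa using hallInner_smul_left 0 0 k

theorem hallInner_zero_right (k : SymFun) : hallInner k 0 = 0 := by
  rw [hallInner_comm, hallInner_zero_left]

theorem hallInner_sum_left {ι : Type*} (s : Finset ι) (f : ι → SymFun) (k : SymFun) :
    hallInner (∑ i ∈ s, f i) k = ∑ i ∈ s, hallInner (f i) k := by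
  classical
  induction s using Finset.induction_on with
  | empty => simp [hallInner_zero_left]
  | insert i s hi ih => rw [Finset.sum_insert hi, Finset.sum_insert hi, hallInner_add_left, ih]

/-- The Hall inner product is nondegenerate. -/
theorem eq_of_hallInner_schur {f g : SymFun}
    (h : ∀ y, hallInner f (schur y) = hallInner g (schur y)) : f = g := by
  obtain ⟨u, rfl⟩ := surjective_schurMap f
  obtain ⟨v, rfl⟩ := surjective_schurMap g
  congr 1
  ext y
  have := h y
  rwa [hallInner_comm, hallInner_schur le_rfl, schurCoeff_schurMap le_rfl, hallInner_comm,
    hallInner_schur le_rfl, schurCoeff_schurMap le_rfl] at this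

/-- In `N` variables `s_y a_δ` is an alternant or `0`, and the coefficient of `X^γ` in the alternant
`a_β` is symmetric in `β` and `γ`. -/
theorem hallInner_jacobi_schur {N : ℕ} (β : Fin N →₀ ℕ) (y : MayaDiagram) :
    hallInner (jacobi N (seqOfExponent β)) (schur y) =
      MvPowerSeries.coeff β (finVars N (schur y) * alternant (staircase N)) := by
  classical
  by_cases hy : y.length ≤ N
  · rw [hallInner_comm, hallInner_schur hy, schurCoeff_apply, finVars_jacobi_mul_alternant,
      finVars_schur_mul_alternant hy, coeff_alternant_comm]
  · rw [finVars_schur_eq_zero (by omega), zero_mul, map_zero]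
    by_cases hβ : Function.Injective β
    · obtain ⟨τ, γ, hγ, h⟩ := exists_strictAnti_comp_perm hβ
      rw [jacobi_eq_sign_smul hγ τ h, hallInner_smul_left, hallInner_schur le_rfl,
        schurCoeff_schur le_rfl, Finsupp.single_apply, if_neg, mul_zero]
      rintro rfl
      exact hy (MayaDiagram.length_ofExponent_le γ hγ)
    · simp only [Function.Injective, not_forall] at hβ
      obtain ⟨i, j, h, hij⟩ := hβ
      rw [jacobi_eq_zero_of_not_injective i.2 j.2 (fun h' => hij (Fin.ext h')), hallInner_zero_left]
      rw [seqOfExponent_coe, seqOfExponent_coe, h]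

/-- The value of `f^⊥` at a Schur function: if `f = ∑ f_α X^α` in `N` variables, it is the sum of
the `f_α s[x - α]`. -/
noncomputable def perpSchur (N : ℕ) (f : SymFun) (x : MayaDiagram) : SymFun :=
  ∑ p ∈ Finset.HasAntidiagonal.antidiagonal (x.exponent N),
    MvPowerSeries.coeff p.1 (finVars N f) • jacobi N (seqOfExponent p.2)

theorem hallInner_perpSchur {N : ℕ} (f : SymFun) {x : MayaDiagram} (hx : x.length ≤ N)
    (y : MayaDiagram) :
    hallInner (perpSchur N f x) (schur y) = hallInner (schur x) (f * schur y) := by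
  classical
  rw [hallInner_schur hx, schurCoeff_apply, map_mul (finVars N), mul_assoc, MvPowerSeries.coeff_mul,
    perpSchur, hallInner_sum_left]
  refine Finset.sum_congr rfl fun p _ => ?_
  rw [hallInner_smul_left, hallInner_jacobi_schur]

theorem exists_hallInner_adjoint (f : SymFun) :
    ∃ D : SymFun →ₗ[ℂ] SymFun, ∀ g k, hallInner (D g) k = hallInner g (f * k) := by
  refine ⟨Finsupp.linearCombination ℂ (fun x : MayaDiagram => perpSchur x.length f x) ∘ₗ
    (LinearEquiv.ofBijective schurMap bijective_schurMap).symm.toLinearMap, fun g k => ?_⟩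
  obtain ⟨u, rfl⟩ := surjective_schurMap g
  obtain ⟨v, rfl⟩ := surjective_schurMap k
  have hu : (LinearEquiv.ofBijective schurMap bijective_schurMap).symm (schurMap u) = u :=
    (LinearEquiv.ofBijective schurMap bijective_schurMap).symm_apply_apply u
  rw [LinearMap.comp_apply, LinearEquiv.coe_coe, hu]
  induction u using Finsupp.induction_linear with
  | zero => simp [hallInner_zero_left]
  | add u u' h h' =>
    rw [map_add, map_add, hallInner_add_left, hallInner_add_left, h, h']
    · exact LinearEquiv.symm_apply_apply _ _
    · exact LinearEquiv.symm_apply_apply _ _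
  | single x c =>
    rw [Finsupp.linearCombination_single, schurMap_single, hallInner_smul_left,
      hallInner_smul_left]
    congr 1
    clear hu
    induction v using Finsupp.induction_linear with
    | zero => simp [hallInner_zero_right]
    | add v v' h h' => rw [map_add, mul_add, hallInner_add_right, hallInner_add_right, h, h']
    | single y c =>
      rw [schurMap_single, mul_smul_comm, hallInner_smul_right, hallInner_smul_right,
        hallInner_perpSchur f le_rfl]

theorem hallInner_perp (f g k : SymFun) : hallInner (perp f g) k = hallInner g (f * k) := by
  rw [perp, dif_pos (exists_hallInner_adjoint f)]
  exact (exists_hallInner_adjoint f).choose_spec g k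

theorem perp_schur {N : ℕ} (f : SymFun) {x : MayaDiagram} (hx : x.length ≤ N) :
    perp f (schur x) = perpSchur N f x :=
  eq_of_hallInner_schur fun y => by rw [hallInner_perp, hallInner_perpSchur f hx]

/-- `(e_r ∘ p_m)^⊥` subtracts `m` from `r` of the entries of a maya diagram, in all possible
ways. -/
theorem perp_plethysmP_eSym_schur {N m : ℕ} (hm : 1 ≤ m) (r : ℕ) {x : MayaDiagram}
    (hx : x.length ≤ N) :
    perp (plethysmP m hm (eSym r)) (schur x) = ∑ S ∈ Finset.powersetCard r Finset.univ,
      jacobi N fun i => x.seq i - if ∃ h : i < N, (⟨i, h⟩ : Fin N) ∈ S then (m : ℤ) else 0 := by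
  classical
  rw [perp_schur _ hx, perpSchur, finVars_plethysmP_eSym]
  simp only [map_sum, Finset.sum_smul]
  rw [Finset.sum_comm]
  refine Finset.sum_congr rfl fun S _ => ?_
  simp only [MvPowerSeries.coeff_monomial, ite_smul, one_smul, zero_smul]
  have hfilter := Finset.HasAntidiagonal.filter_fst_eq_antidiagonal (x.exponent N)
    (Finsupp.indicator S fun _ _ => m)
  rw [← Finset.sum_filter, Finset.sum_congr (by convert! hfilter) fun _ _ => rfl]
  split_ifs with h
  · rw [Finset.sum_singleton]
    refine jacobi_congr fun i hi => ?_
    have h1 := seqOfExponent_coe (x.exponent N - Finsupp.indicator S fun _ _ => m) ⟨i, hi⟩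
    have h2 := x.coe_exponent hx ⟨i, hi⟩
    have h3 := h ⟨i, hi⟩
    simp only [Finsupp.coe_tsub, Pi.sub_apply] at h1 h2
    rw [h1, Nat.cast_sub h3, h2, Finsupp.indicator_apply]
    by_cases hS : (⟨i, hi⟩ : Fin N) ∈ S
    · simp only [hS, hi, exists_const, if_true, dif_pos]
      ring
    · simp [hS]
  · rw [Finset.sum_empty]
    obtain ⟨i, hi⟩ : ∃ i, x.exponent N i < Finsupp.indicator S (fun _ _ => m) i := by
      by_contra! h'
      exact h h'
    refine (jacobi_eq_zero_of_lt i.2 ?_).symm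
    have h2 := x.coe_exponent hx i
    rw [Finsupp.indicator_apply] at hi
    split_ifs at hi with hS
    · simp only [i.2, Fin.eta, hS, exists_const, if_true]
      omega
    · omega

/-! ### A circulant determinant -/

open PowerSeries in
/-- The power series `∑ h_{m (l - K) + s} z^l`: up to a power of `z`, the part of the series
`∑ h_r t^r` in which `r ≡ s` modulo `m`, with `t^m = z`. -/
noncomputable def residueSeries {R : Type*} [CommRing R] (h : ℤ → R) (m K : ℕ) (s : ℤ) : R⟦X⟧ :=
  PowerSeries.mk fun l => h (m * ((l : ℤ) - K) + s)

theorem X_mul_residueSeries {R : Type*} [CommRing R] {h : ℤ → R} (hneg : ∀ r < 0, h r = 0)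
    {m K : ℕ} {s : ℤ} (hs : s < m * (K + 1)) :
    PowerSeries.X * residueSeries h m K s = residueSeries h m K (s - m) := by
  ext l
  rcases l with _ | l
  · rw [PowerSeries.coeff_zero_X_mul, residueSeries, PowerSeries.coeff_mk, hneg]
    push_cast
    linarith
  · rw [PowerSeries.coeff_succ_X_mul, residueSeries, residueSeries, PowerSeries.coeff_mk,
      PowerSeries.coeff_mk]
    congr 1
    push_cast
    ring

/-- The matrix `1 - x P`, where `P` is the cyclic shift with `P ^ (m + 1) = z`. -/
def oneSubShift {R : Type*} [CommRing R] (m : ℕ) (x z : R) : Matrix (Fin (m + 1)) (Fin (m + 1)) R :=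
  Matrix.of fun k j => (if k = j then 1 else 0) -
    x * Fin.cases (if k = Fin.last m then z else 0) (fun j => if k = j.castSucc then 1 else 0) j

theorem sum_mul_oneSubShift {R : Type*} [CommRing R] (m : ℕ) (x z : R) (f : Fin (m + 1) → R)
    (j : Fin (m + 1)) : ∑ k, f k * oneSubShift m x z k j =
      f j - x * Fin.cases (f (Fin.last m) * z) (fun j => f j.castSucc) j := by
  simp only [oneSubShift, Matrix.of_apply, mul_sub, Finset.sum_sub_distrib]
  congr 1
  · simp
  · cases j using Fin.cases with
    | zero => simp [mul_left_comm]
    | succ j => simp [mul_comm]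

theorem det_oneSubShift {R : Type*} [CommRing R] (m : ℕ) (x z : R) :
    (oneSubShift m x z).det = 1 - x ^ (m + 1) * z := by
  -- the inverse of the matrix without its corner entry
  set V : Matrix (Fin (m + 1)) (Fin (m + 1)) R :=
    Matrix.of fun i j => if i ≤ j then x ^ ((j : ℕ) - i) else 0 with hV
  have h1 : V.det = 1 := by
    rw [Matrix.det_of_isUpperTriangular]
    · simp [hV]
    · intro i j hij
      have : ¬ i ≤ j := not_le.2 hij
      simp [hV, this]
  have hcol : ∀ i (j : Fin m), (V * oneSubShift m x z) i j.succ = if i = j.succ then 1 else 0 := by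
    intro i j
    rw [Matrix.mul_apply, sum_mul_oneSubShift]
    simp only [hV, Matrix.of_apply, Fin.cases_succ]
    rcases lt_trichotomy i j.succ with h | h | h
    · have h2 : i ≤ j.castSucc := Fin.le_castSucc_iff.2 h
      have h3 : (j.succ : ℕ) - i = ((j.castSucc : ℕ) - i) + 1 := by
        have : (i : ℕ) ≤ j := h2
        simp only [Fin.val_succ, Fin.val_castSucc]
        omega
      rw [if_pos h.le, if_pos h2, if_neg h.ne, h3, pow_succ']
      ring
    · subst h
      simp
    · have h2 : ¬ i ≤ j.castSucc := fun h' => absurd (Fin.le_castSucc_iff.1 h') h.not_gt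
      rw [if_neg h.not_ge, if_neg h2, if_neg h.ne']
      ring
  have h2 : (V * oneSubShift m x z).det = 1 - x ^ (m + 1) * z := by
    rw [Matrix.det_of_isLowerTriangular, Fin.prod_univ_succ]
    · simp only [hcol, if_true, Finset.prod_const_one, mul_one]
      rw [Matrix.mul_apply, sum_mul_oneSubShift]
      simp only [hV, Matrix.of_apply, Fin.cases_zero, Fin.zero_le, if_true, Fin.val_last]
      simp only [Fin.val_zero, Nat.sub_zero, pow_zero, pow_succ']
      ring
    · intro i j hij
      have hij : i < j := hij
      obtain ⟨j, rfl⟩ :=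
        Fin.exists_succ_eq_of_ne_zero (ne_of_gt (lt_of_le_of_lt (Fin.zero_le i) hij))
      rw [hcol, if_neg hij.ne]
  rw [← h2, Matrix.det_mul, h1, one_mul]

/-- Multiplication by `1 - X_i P` removes the variable `X_i` from the circulant matrix of the
`h_r`. -/
theorem residueSeries_mul_oneSubShift {N : ℕ} (m K : ℕ) {S : Finset (Fin N)} {i : Fin N}
    (hi : i ∈ S) :
    (Matrix.of fun a b : Fin (m + 1) =>
      residueSeries (completeIn 1 S) (m + 1) K ((b : ℤ) - a)) *
        oneSubShift m (PowerSeries.C (MvPowerSeries.X i)) PowerSeries.X =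
    Matrix.of fun a b : Fin (m + 1) =>
      residueSeries (completeIn 1 (S.erase i)) (m + 1) K ((b : ℤ) - a) := by
  have hneg : ∀ r < 0, completeIn 1 S r = 0 := fun r hr => completeIn_neg le_rfl S hr
  have hrec : ∀ s, residueSeries (completeIn 1 (S.erase i)) (m + 1) K s =
      residueSeries (completeIn 1 S) (m + 1) K s - PowerSeries.C (MvPowerSeries.X i) *
        residueSeries (completeIn 1 S) (m + 1) K (s - 1) := by
    intro s
    ext1 l
    rw [map_sub, PowerSeries.coeff_C_mul]
    simp only [residueSeries, PowerSeries.coeff_mk]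
    rw [completeIn_eq_erase_add le_rfl hi (_ + s), pow_one, add_sub_assoc _ s 1,
      add_sub_cancel_right]
  ext1 a b
  refine (sum_mul_oneSubShift m _ _ (fun b : Fin (m + 1) =>
    residueSeries (completeIn 1 S) (m + 1) K ((b : ℤ) - a)) b).trans ?_
  rw [Matrix.of_apply, hrec]
  congr 2
  cases b using Fin.cases with
  | zero =>
    rw [Fin.cases_zero, mul_comm, X_mul_residueSeries hneg]
    · congr 1
      simp only [Fin.val_last, Fin.val_zero]
      push_cast
      ring
    · simp only [Fin.val_last]
      push_cast
      nlinarith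
  | succ b =>
    rw [Fin.cases_succ]
    congr 1
    simp only [Fin.val_succ, Fin.val_castSucc]
    push_cast
    ring

theorem det_residueSeries_completeIn {N : ℕ} (m K : ℕ) (S : Finset (Fin N)) :
    (Matrix.of fun a b : Fin (m + 1) =>
      residueSeries (completeIn 1 S) (m + 1) K ((b : ℤ) - a)).det *
        ∏ i ∈ S, (1 - PowerSeries.C (MvPowerSeries.X i) ^ (m + 1) * PowerSeries.X) =
      PowerSeries.X ^ ((m + 1) * K) := by
  classical
  induction S using Finset.induction_on with
  | empty =>
    have h : (Matrix.of fun a b : Fin (m + 1) => residueSeries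
        (completeIn 1 (∅ : Finset (Fin N))) (m + 1) K ((b : ℤ) - a)) =
        Matrix.diagonal fun _ => PowerSeries.X ^ K := by
      ext1 a b
      ext1 l
      rw [Matrix.of_apply, Matrix.diagonal_apply, residueSeries, PowerSeries.coeff_mk,
        completeIn_empty le_rfl]
      have ha := a.2
      have hb := b.2
      by_cases hab : a = b
      · subst hab
        rw [if_pos rfl, PowerSeries.coeff_X_pow]
        congr 1
        simp [sub_eq_zero]
        omega
      · rw [if_neg hab, map_zero, if_neg]
        intro h0
        have h1 : ((m + 1 : ℕ) : ℤ) ∣ (b : ℤ) - a := ⟨K - l, by linarith⟩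
        -- `b - a` is a multiple of the size of the matrix
        have h2 := Int.eq_zero_of_abs_lt_dvd h1 (by rw [abs_lt]; constructor <;> omega)
        exact hab (Fin.ext (by omega))
    rw [h, Matrix.det_diagonal, Finset.prod_const, Finset.card_univ, Fintype.card_fin,
      Finset.prod_empty, mul_one, ← pow_mul, mul_comm]
  | insert i S hi ih =>
    have h := congrArg Matrix.det
      (residueSeries_mul_oneSubShift m K (Finset.mem_insert_self i S))
    rw [Finset.erase_insert hi, Matrix.det_mul, det_oneSubShift] at h
    rw [Finset.prod_insert hi, ← mul_assoc, h, ih]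

theorem mk_completeIn_mul_prod {N m : ℕ} (hm : 1 ≤ m) (M : ℕ) (S : Finset (Fin N)) :
    (PowerSeries.mk fun l => completeIn m S ((l : ℤ) - M)) *
        ∏ i ∈ S, (1 - PowerSeries.C (MvPowerSeries.X i) ^ m * PowerSeries.X) =
      PowerSeries.X ^ M := by
  classical
  induction S using Finset.induction_on with
  | empty =>
    ext1 l
    rw [Finset.prod_empty, mul_one, PowerSeries.coeff_mk, completeIn_empty hm,
      PowerSeries.coeff_X_pow]
    congr 1
    simp [sub_eq_zero]
  | insert i S hi ih =>
    rw [Finset.prod_insert hi, ← mul_assoc, ← ih]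
    congr 1
    have hrec := completeIn_eq_erase_add hm (Finset.mem_insert_self i S)
    rw [Finset.erase_insert hi] at hrec
    rw [mul_sub, mul_one, mul_comm _ (_ * _), mul_assoc, ← map_pow]
    ext1 l
    rw [map_sub, PowerSeries.coeff_C_mul]
    rcases l with _ | l
    · rw [PowerSeries.coeff_zero_X_mul, PowerSeries.coeff_mk, PowerSeries.coeff_mk, hrec,
        completeIn_neg hm _ (r := ((0 : ℕ) : ℤ) - M - 1) (by push_cast; omega)]
      ring
    · rw [PowerSeries.coeff_succ_X_mul, PowerSeries.coeff_mk, PowerSeries.coeff_mk,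
        PowerSeries.coeff_mk, hrec]
      rw [show ((l + 1 : ℕ) : ℤ) - M - 1 = l - M by push_cast; ring]
      ring

/-- With `z = t^m`, the circulant determinant of the parts of `H(t) = ∑ h_r t^r` is the product of
the `H(ω t)` over the `m`-th roots of unity `ω`, that is the generating function of the
`h_n ∘ p_m`. -/
theorem det_residueSeries_hSym {m : ℕ} (hm : 1 ≤ m) (K : ℕ) :
    (Matrix.of fun a b : Fin m => residueSeries hSym m K ((b : ℤ) - a)).det =
      PowerSeries.mk fun l => plethysmP m hm (hSym ((l : ℤ) - (m * K : ℕ))) := by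
  have key : ∀ N, PowerSeries.map (finVars N).toRingHom
      (Matrix.of fun a b : Fin m => residueSeries hSym m K ((b : ℤ) - a)).det =
      PowerSeries.map (finVars N).toRingHom
        (PowerSeries.mk fun l => plethysmP m hm (hSym ((l : ℤ) - (m * K : ℕ)))) := by
    intro N
    have h1 : PowerSeries.map (finVars N).toRingHom
        (Matrix.of fun a b : Fin m => residueSeries hSym m K ((b : ℤ) - a)).det =
        (Matrix.of fun a b : Fin m => residueSeries
          (completeIn 1 (Finset.univ : Finset (Fin N))) m K ((b : ℤ) - a)).det := by
      rw [RingHom.map_det]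
      congr 1
      ext1 a b
      ext1 l
      exact finVars_hSym N _
    have h2 : PowerSeries.map (finVars N).toRingHom
        (PowerSeries.mk fun l => plethysmP m hm (hSym ((l : ℤ) - (m * K : ℕ)))) =
        PowerSeries.mk fun l =>
          completeIn m (Finset.univ : Finset (Fin N)) ((l : ℤ) - (m * K : ℕ)) := by
      ext1 l
      exact finVars_plethysmP_hSym N hm _
    have hunit : IsUnit (∏ i : Fin N, (1 - PowerSeries.C
        (MvPowerSeries.X i : MvPowerSeries (Fin N) ℂ) ^ m * PowerSeries.X)) := by
      rw [PowerSeries.isUnit_iff_constantCoeff]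
      simp
    rw [h1, h2]
    refine hunit.mul_right_cancel ?_
    rw [mk_completeIn_mul_prod hm]
    obtain ⟨m, rfl⟩ : ∃ m', m = m' + 1 := ⟨m - 1, by omega⟩
    exact det_residueSeries_completeIn m K Finset.univ
  ext1 l
  refine symFun_ext_finVars fun N => ?_
  have := congrArg (PowerSeries.coeff l) (key N)
  rwa [PowerSeries.coeff_map, PowerSeries.coeff_map] at this

/-! ### The determinant of `φ` -/

/-- The coefficients of a determinant whose first rows have power series as entries and whose last
rows are constant. -/
theorem coeff_det_addCases {R : Type*} [CommRing R] {m L : ℕ}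
    (A : Fin m → Fin (m + L) → PowerSeries R) (B : Fin L → Fin (m + L) → R) (D : ℕ) :
    PowerSeries.coeff D (Matrix.of fun r c : Fin (m + L) =>
      Fin.addCases (fun i => A i c) (fun i => PowerSeries.C (B i c)) r).det =
    ∑ l ∈ Finset.finsuppAntidiag Finset.univ D, (Matrix.of fun r c : Fin (m + L) =>
      Fin.addCases (fun i => PowerSeries.coeff (l i) (A i c)) (fun i => B i c) r).det := by
  classical
  have h1 : ∀ σ : Equiv.Perm (Fin (m + L)), PowerSeries.coeff D
      (∏ r, (Fin.addCases (fun i => A i (σ r)) (fun i => PowerSeries.C (B i (σ r))) r :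
        PowerSeries R)) = ∑ l ∈ Finset.finsuppAntidiag Finset.univ D,
      ∏ r, (Fin.addCases (fun i => PowerSeries.coeff (l i) (A i (σ r))) (fun i => B i (σ r)) r :
        R) := by
    intro σ
    simp only [Fin.prod_univ_add, Fin.addCases_left, Fin.addCases_right]
    rw [← map_prod, PowerSeries.coeff_mul_C, PowerSeries.coeff_prod, Finset.sum_mul]
  rw [← Matrix.det_transpose, Matrix.det_apply', map_sum]
  simp only [← zsmul_eq_mul, map_zsmul, Matrix.transpose_apply, Matrix.of_apply, h1,
    Finset.smul_sum]
  rw [Finset.sum_comm]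
  refine Finset.sum_congr rfl fun l _ => ?_
  rw [← Matrix.det_transpose, Matrix.det_apply']
  simp only [← zsmul_eq_mul, Matrix.transpose_apply, Matrix.of_apply]

/-- Column operations: from `z` times each column but the first `m`, subtract the column `m` places
before it. -/
noncomputable def columnShift (R : Type*) [CommRing R] (m L : ℕ) :
    Matrix (Fin (m + L)) (Fin (m + L)) (PowerSeries R) :=
  Matrix.of fun c d => if (d : ℕ) < m then (if c = d then 1 else 0) else
    (if c = d then PowerSeries.X else 0) - (if (c : ℕ) + m = d then 1 else 0)

theorem det_columnShift (R : Type*) [CommRing R] {m : ℕ} (hm : 1 ≤ m) (L : ℕ) :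
    (columnShift R m L).det = PowerSeries.X ^ L := by
  rw [Matrix.det_of_isUpperTriangular, Fin.prod_univ_add]
  · have h1 : ∀ i : ℕ, i ≠ m + i + m := fun i => by omega
    have h2 : m ≠ 0 := by omega
    simp [columnShift, h2]
  · intro c d hcd
    have h1 : (d : ℕ) < c := hcd
    have h2 : c ≠ d := ne_of_gt hcd
    have h3 : (c : ℕ) + m ≠ d := by omega
    simp [columnShift, h2, h3]

theorem sum_mul_columnShift_left {R : Type*} [CommRing R] {m L : ℕ}
    (f : Fin (m + L) → PowerSeries R) (j : Fin m) :
    ∑ c, f c * columnShift R m L c (Fin.castAdd L j) = f (Fin.castAdd L j) := by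
  simp [columnShift]

theorem sum_mul_columnShift_right {R : Type*} [CommRing R] {m L : ℕ}
    (f : ℕ → PowerSeries R) (k : Fin L) :
    ∑ c : Fin (m + L), f c * columnShift R m L c (Fin.natAdd m k) =
      f (m + k) * PowerSeries.X - f k := by
  have h : ∀ c : Fin (m + L), (c : ℕ) + m = (Fin.natAdd m k : Fin (m + L)) ↔
      c = ⟨k, by have := k.2; omega⟩ := by
    intro c
    rw [Fin.ext_iff, Fin.val_natAdd]
    simp only
    omega
  have hkm : ¬ ((Fin.natAdd m k : Fin (m + L)) : ℕ) < m := by simp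
  simp only [columnShift, Matrix.of_apply, if_neg hkm, mul_sub, Finset.sum_sub_distrib, h]
  simp

/-- If the rows of the first kind satisfy `g_c = z g_{c + m}`, the column operations bring the
matrix into block triangular form. -/
theorem det_residueSeries_fromRows {R : Type*} [CommRing R] {h : ℤ → R}
    (hneg : ∀ r < 0, h r = 0) {m L K : ℕ} (hm : 1 ≤ m) (hK : L ≤ K) (x : ℕ → ℤ) :
    (Matrix.of fun r c : Fin (m + L) => (Fin.addCases
      (fun i : Fin m => residueSeries h m K ((c : ℤ) - i))
      (fun i : Fin L => PowerSeries.C (h (x i - m + c + 1))) r : PowerSeries R)).det *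
        PowerSeries.X ^ L =
    (Matrix.of fun i j : Fin m => residueSeries h m K ((j : ℤ) - i)).det *
      (Matrix.of fun i k : Fin L => PowerSeries.C (h (x i + k + 1)) * PowerSeries.X -
        PowerSeries.C (h (x i - m + k + 1))).det := by
  rw [← det_columnShift R hm L, ← Matrix.det_mul, ← Matrix.det_fromBlocks_zero₁₂ _
    (Matrix.of fun (i : Fin L) (j : Fin m) => PowerSeries.C (h (x i - m + j + 1))) _,
    ← Matrix.det_reindex_self finSumFinEquiv]
  congr 1
  ext1 r c
  rw [Matrix.reindex_apply, Matrix.submatrix_apply, Matrix.mul_apply]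
  refine Fin.addCases (fun i => ?_) (fun i => ?_) r
  · simp only [Matrix.of_apply, Fin.addCases_left, finSumFinEquiv_symm_apply_castAdd]
    refine Fin.addCases (fun j => ?_) (fun k => ?_) c
    · rw [sum_mul_columnShift_left (fun c => residueSeries h m K ((c : ℤ) - i)),
        finSumFinEquiv_symm_apply_castAdd, Matrix.fromBlocks_apply₁₁]
      rfl
    · rw [sum_mul_columnShift_right (fun c => residueSeries h m K ((c : ℤ) - i)),
        finSumFinEquiv_symm_apply_natAdd, Matrix.fromBlocks_apply₁₂, Matrix.zero_apply, mul_comm,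
        X_mul_residueSeries hneg, sub_eq_zero]
      · congr 1
        push_cast
        ring
      · have h1 := k.2
        have h2 : (K : ℤ) ≤ m * K := by nlinarith [Int.natCast_nonneg K]
        push_cast
        rw [mul_add]
        omega
  · simp only [Matrix.of_apply, Fin.addCases_right, finSumFinEquiv_symm_apply_natAdd]
    refine Fin.addCases (fun j => ?_) (fun k => ?_) c
    · rw [sum_mul_columnShift_left (fun c => PowerSeries.C (h (x i - m + c + 1))),
        finSumFinEquiv_symm_apply_castAdd, Matrix.fromBlocks_apply₂₁]
      rfl
    · rw [sum_mul_columnShift_right (fun c => PowerSeries.C (h (x i - m + c + 1))),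
        finSumFinEquiv_symm_apply_natAdd, Matrix.fromBlocks_apply₂₂, Matrix.of_apply]
      congr 4
      push_cast
      ring

theorem det_shifted_rows {R : Type*} [CommRing R] (h : ℤ → R) (m L : ℕ) (x : ℕ → ℤ) :
    (Matrix.of fun i k : Fin L => PowerSeries.C (h (x i + k + 1)) * PowerSeries.X -
        PowerSeries.C (h (x i - m + k + 1))).det =
    ∑ S : Finset (Fin L), (-1) ^ S.card * PowerSeries.X ^ (L - S.card) *
      PowerSeries.C (Matrix.of fun i k : Fin L =>
        h (x i - (if i ∈ S then (m : ℤ) else 0) + k + 1)).det := by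
  classical
  have h1 := MultilinearMap.map_add_univ
    (Matrix.detRowAlternating (n := Fin L) (R := PowerSeries R)).toMultilinearMap
    (fun i k => -PowerSeries.C (h (x i - m + k + 1)))
    (fun i k => PowerSeries.C (h (x i + k + 1)) * PowerSeries.X)
  refine Eq.trans (congrArg Matrix.det ?_) (h1.trans (Finset.sum_congr rfl fun S _ => ?_))
  · ext1 i k
    simp [sub_eq_neg_add]
  · have h2 : (Matrix.of (S.piecewise (fun i k => -PowerSeries.C (h (x i - m + k + 1)))
        (fun i k => PowerSeries.C (h (x i + k + 1)) * PowerSeries.X)) :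
          Matrix (Fin L) (Fin L) (PowerSeries R)) =
        Matrix.of fun i k => (if i ∈ S then -1 else PowerSeries.X) * (PowerSeries.C.mapMatrix
          (Matrix.of fun i k : Fin L => h (x i - (if i ∈ S then (m : ℤ) else 0) + k + 1))) i k := by
      ext1 i k
      by_cases hi : i ∈ S
      · simp [hi]
      · simp [hi, mul_comm]
    have h3 := congrArg Matrix.det h2
    rw [Matrix.det_mul_column, ← RingHom.map_det] at h3
    refine h3.trans ?_
    congr 1
    rw [Finset.prod_ite, Finset.prod_const, Finset.prod_const, Finset.filter_mem_eq_inter,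
      Finset.univ_inter, Finset.filter_not, Finset.filter_mem_eq_inter, Finset.univ_inter,
      ← Finset.compl_eq_univ_sdiff, Finset.card_compl, Fintype.card_fin]

/-! ### The formula -/

/-- The tuple `a` with `a_{m-1-i} = m (l_i - K) + (m - 1 - i)`. -/
def tupleOfExponent {m : ℕ} (K : ℕ) (l : Fin m →₀ ℕ) : Fin m → ℤ :=
  fun j => m * ((l j.rev : ℤ) - K) + j

theorem tupleOfExponent_injective {m : ℕ} (K : ℕ) :
    Function.Injective (tupleOfExponent (m := m) K) := by
  intro l l' h
  ext i
  have h1 := congrFun h i.rev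
  have hm : (m : ℤ) ≠ 0 := by have := i.2; omega
  simp only [tupleOfExponent, Fin.rev_rev, add_left_inj] at h1
  have h2 := mul_left_cancel₀ hm h1
  omega

theorem tupleOfExponent_mem {m : ℕ} (hm : 1 ≤ m) {K : ℕ} {n : ℤ} {l : Fin m →₀ ℕ} :
    tupleOfExponent K l ∈ phiIndex m (-n) ↔ (l.degree : ℤ) = n + m * K := by
  have h : ∑ i, tupleOfExponent K l i = m * ((l.degree : ℤ) - m * K) + ∑ i : Fin m, (i : ℤ) := by
    have h0 := Equiv.sum_comp Fin.revPerm (fun i => (l i : ℤ))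
    simp only [Fin.revPerm_apply] at h0
    simp only [tupleOfExponent]
    rw [Finset.sum_add_distrib, ← Finset.mul_sum, Finset.sum_sub_distrib, h0,
      Finsupp.degree_eq_sum]
    simp
  have hm0 : (m : ℤ) ≠ 0 := by omega
  rw [phiIndex, Set.mem_ofPred_eq, h]
  constructor
  · rintro ⟨-, h2⟩
    have h3 : (m : ℤ) * ((l.degree : ℤ) - m * K) = m * n := by linarith
    linarith [mul_left_cancel₀ hm0 h3]
  · intro h2
    refine ⟨fun i => by simp [tupleOfExponent, Int.ModEq], ?_⟩
    rw [h2]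
    ring

theorem schurMap_bracket_prependShift {m L : ℕ} (a : Fin m → ℤ) {x : MayaDiagram}
    (hx : x.length ≤ L) :
    schurMap (bracket (prependShift a x.seq)) = jacobi (m + L) (prependShift a x.seq) := by
  refine schurMap_bracket fun i hi => ?_
  rw [prependShift, dif_neg (by omega), x.seq_eq_of_length_le (by omega)]
  omega

/-- The value of `φ` at a maya diagram as a finite sum: only the tuples which are bounded below
contribute. -/
theorem schurMap_phi_single {m : ℕ} (hm : 1 ≤ m) {L K D : ℕ} {n : ℤ} {x : MayaDiagram}
    (hx : x.length ≤ L) (hK : L ≤ K) (hD : (D : ℤ) = n + m * K) :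
    schurMap (phi m (-n) (Finsupp.single x 1)) =
      ∑ l ∈ Finset.finsuppAntidiag (Finset.univ : Finset (Fin m)) D,
        jacobi (m + L) (prependShift (tupleOfExponent K l) x.seq) := by
  classical
  rw [phi, Finsupp.linearCombination_single, one_smul]
  have h1 := AddMonoidHom.map_finsum schurMap.toAddMonoidHom (finite_support_phi m (-n) x)
  refine h1.trans ?_
  have h2 : ∀ a : phiIndex m (-n), schurMap.toAddMonoidHom (bracket (prependShift a.1 x.seq)) =
      jacobi (m + L) (prependShift a.1 x.seq) := fun a =>
    schurMap_bracket_prependShift a.1 hx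
  rw [finsum_congr h2, finsum_set_coe_eq_finsum_mem (phiIndex m (-n))
      (f := fun a => jacobi (m + L) (prependShift a x.seq)),
    ← Finset.sum_image (g := tupleOfExponent K)
      (f := fun a => jacobi (m + L) (prependShift a x.seq))
      fun _ _ _ _ h => tupleOfExponent_injective K h]
  refine finsum_mem_eq_sum_of_inter_support_eq _ ?_
  ext a
  simp only [Set.mem_inter_iff, Function.mem_support, Finset.coe_image, Set.mem_image,
    Finset.mem_coe, Finset.mem_finsuppAntidiag, Finset.subset_univ, and_true]
  refine and_congr_left fun hne => ⟨fun ha => ?_, ?_⟩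
  · have hq : ∀ i, ∃ q : ℤ, a i = m * q + i := fun i => by
      obtain ⟨q, hq⟩ := (ha.1 i).symm.dvd
      exact ⟨q, by linarith⟩
    choose q hq using hq
    have hlow : ∀ i, 0 ≤ q i + K := by
      intro i
      by_contra! hlt
      -- otherwise a row of the Jacobi–Trudi determinant vanishes
      refine hne (jacobi_eq_zero_of_lt (i := i.rev) (by have := i.rev.2; omega) ?_)
      have h3 : (m : ℤ) * q i ≤ m * (-K - 1) := by
        apply mul_le_mul_of_nonneg_left <;> omega
      have h4 : (K : ℤ) ≤ m * K := by nlinarith [Int.natCast_nonneg K]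
      have h5 := i.2
      rw [prependShift, dif_pos i.rev.2, Fin.eta, Fin.rev_rev, hq]
      push_cast
      linarith [show (i : ℤ) < m by omega, show (L : ℤ) ≤ K by omega]
    have hl : tupleOfExponent K (Finsupp.equivFunOnFinite.symm fun i => (q i.rev + K).toNat) =
        a := by
      ext i
      simp only [tupleOfExponent, Finsupp.equivFunOnFinite_symm_apply_apply, Fin.rev_rev]
      rw [Int.toNat_of_nonneg (hlow i), hq, add_sub_cancel_right]
    refine ⟨_, ?_, hl⟩
    rw [← hl, tupleOfExponent_mem hm, ← hD, Finsupp.degree_eq_sum] at ha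
    exact_mod_cast ha
  · rintro ⟨l, hl, rfl⟩
    rw [tupleOfExponent_mem hm, ← hD, Finsupp.degree_eq_sum, hl]

theorem schurMap_phi_eq_sum {m : ℕ} (hm : 1 ≤ m) (n : ℤ) (x : MayaDiagram) :
    schurMap (phi m (-n) (Finsupp.single x 1)) = ∑ S : Finset (Fin x.length),
      (-1) ^ S.card * (plethysmP m hm (hSym (n + S.card)) * jacobi x.length fun i =>
        x.seq i - if ∃ h : i < x.length, (⟨i, h⟩ : Fin x.length) ∈ S then (m : ℤ) else 0) := by
  classical
  set L := x.length with hL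
  -- `K` is large enough for all the exponents to be nonnegative
  set K := L + n.natAbs with hK
  obtain ⟨D, hD⟩ : ∃ D : ℕ, (D : ℤ) = n + m * K := by
    refine ⟨(n + m * K).toNat, Int.toNat_of_nonneg ?_⟩
    have : (K : ℤ) ≤ m * K := by nlinarith [Int.natCast_nonneg K]
    omega
  have hKD : (m * K : ℕ) = (D : ℤ) - n := by push_cast; linarith
  rw [schurMap_phi_single hm hL.ge (show L ≤ K by omega) hD]
  have h1 := congrArg (PowerSeries.coeff (D + L)) (det_residueSeries_fromRows
    (fun r hr => hSym_of_neg hr) hm (show L ≤ K by omega) x.seq)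
  rw [PowerSeries.coeff_mul_X_pow, coeff_det_addCases, det_residueSeries_hSym hm,
    det_shifted_rows, Finset.mul_sum, map_sum] at h1
  refine Eq.trans (Finset.sum_congr rfl fun l _ => ?_) (h1.trans
    (Finset.sum_congr rfl fun S _ => ?_))
  · rw [jacobi]
    congr 1
    ext1 r c
    rw [Matrix.of_apply, Matrix.of_apply]
    refine Fin.addCases (fun i => ?_) (fun i => ?_) r
    · have h2 := i.2
      rw [Fin.addCases_left, residueSeries, PowerSeries.coeff_mk, Fin.val_castAdd, prependShift,
        dif_pos i.2, tupleOfExponent, Fin.eta, Fin.rev_rev, Fin.val_rev]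
      congr 1
      rw [Nat.cast_sub (by omega)]
      push_cast
      ring
    · rw [Fin.addCases_right, Fin.val_natAdd, prependShift, dif_neg (by omega),
        Nat.add_sub_cancel_left]
  · have hS : S.card ≤ L := by simpa using Finset.card_le_univ S
    have h2 : D + L = D + S.card + (L - S.card) := by omega
    have h3 : ∀ T J : PowerSeries SymFun, T * ((-1) ^ S.card * PowerSeries.X ^ (L - S.card) * J) =
        (-1) ^ S.card * (T * J * PowerSeries.X ^ (L - S.card)) := fun T J => by ring
    have h4 : ((-1) ^ S.card : PowerSeries SymFun) = PowerSeries.C ((-1) ^ S.card) := by simp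
    rw [h3, h4, PowerSeries.coeff_C_mul, h2, PowerSeries.coeff_mul_X_pow, PowerSeries.coeff_mul_C,
      PowerSeries.coeff_mk, hKD, jacobi]
    congr 3
    · congr 2
      push_cast
      ring
    · ext1 i k
      simp

theorem perp_plethysmP_eSym_eq_zero {m : ℕ} (hm : 1 ≤ m) {x : MayaDiagram} {r : ℕ}
    (hr : x.length < r) : perp (plethysmP m hm (eSym r)) (schur x) = 0 := by
  rw [perp_plethysmP_eSym_schur hm r le_rfl, Finset.powersetCard_eq_empty.2, Finset.sum_empty]
  simpa using hr

/-- The summands of the right-hand side of the formula, as linear operators. -/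
noncomputable def vertexSummand (m : ℕ) (hm : 1 ≤ m) (n : ℤ) (i : ℕ) : FockSpace →ₗ[ℂ] SymFun :=
  (-1 : ℂ) ^ i • (LinearMap.mulLeft ℂ (plethysmP m hm (hSym (n + i))) ∘ₗ
    perp (plethysmP m hm (eSym i)) ∘ₗ schurMap)

theorem vertexSummand_apply {m : ℕ} (hm : 1 ≤ m) (n : ℤ) (i : ℕ) (v : FockSpace) :
    vertexSummand m hm n i v = (-1 : ℂ) ^ i • (plethysmP m hm (hSym (n + i)) *
      perp (plethysmP m hm (eSym i)) (schurMap v)) := rfl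

theorem vertexSummand_single_eq_zero {m : ℕ} (hm : 1 ≤ m) (n : ℤ) {i : ℕ} {x : MayaDiagram}
    (hi : x.length < i) (c : ℂ) : vertexSummand m hm n i (Finsupp.single x c) = 0 := by
  rw [vertexSummand_apply, schurMap_single, map_smul, perp_plethysmP_eSym_eq_zero hm hi, smul_zero,
    mul_zero, smul_zero]

theorem schurMap_phi_single_eq_sum {m : ℕ} (hm : 1 ≤ m) (n : ℤ) (x : MayaDiagram) :
    schurMap (phi m (-n) (Finsupp.single x 1)) =
      ∑ i ∈ Finset.range (x.length + 1), vertexSummand m hm n i (Finsupp.single x 1) := by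
  have h := Finset.sum_powerset (Finset.univ : Finset (Fin x.length)) fun S =>
    (-1 : SymFun) ^ S.card * (plethysmP m hm (hSym (n + S.card)) * jacobi x.length fun i =>
      x.seq i - if ∃ h : i < x.length, (⟨i, h⟩ : Fin x.length) ∈ S then (m : ℤ) else 0)
  rw [Finset.powerset_univ, Finset.card_univ, Fintype.card_fin] at h
  rw [schurMap_phi_eq_sum hm, h]
  refine Finset.sum_congr rfl fun i _ => ?_
  rw [vertexSummand_apply, schurMap_single, one_smul, perp_plethysmP_eSym_schur hm i le_rfl,
    Finset.mul_sum, Finset.smul_sum]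
  refine Finset.sum_congr rfl fun S hS => ?_
  rw [(Finset.mem_powersetCard.1 hS).2, Algebra.smul_def, map_pow, map_neg, map_one]

theorem finite_support_vertexSummand {m : ℕ} (hm : 1 ≤ m) (n : ℤ) (v : FockSpace) :
    (Function.support fun i : ℕ => vertexSummand m hm n i v).Finite := by
  induction v using Finsupp.induction_linear with
  | zero => simp
  | add u v hu hv =>
    refine (hu.union hv).subset fun i hi => ?_
    by_contra h
    simp only [Set.mem_union, Function.mem_support, not_or, not_not] at h
    exact hi (by simp only [map_add, h.1, h.2, add_zero])
  | single x c =>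
    refine (Finset.range (x.length + 1)).finite_toSet.subset fun i hi => ?_
    by_contra h
    exact hi (vertexSummand_single_eq_zero hm n (by simpa using h) c)

theorem schurMap_phi_eq_finsum {m : ℕ} (hm : 1 ≤ m) (n : ℤ) (v : FockSpace) :
    schurMap (phi m (-n) v) = ∑ᶠ i : ℕ, vertexSummand m hm n i v := by
  induction v using Finsupp.induction_linear with
  | zero => simp
  | add u v hu hv =>
    rw [map_add, map_add, hu, hv, ← finsum_add_distrib (finite_support_vertexSummand hm n u)
      (finite_support_vertexSummand hm n v)]
    simp only [map_add]
  | single x c =>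
    rw [finsum_eq_sum_of_support_subset (s := Finset.range (x.length + 1))]
    · rw [← mul_one c, ← smul_eq_mul, ← Finsupp.smul_single]
      simp only [map_smul]
      rw [schurMap_phi_single_eq_sum hm, Finset.smul_sum]
    · intro i hi
      by_contra h
      exact hi (vertexSummand_single_eq_zero hm n (by simpa using h) c)

theorem mainTheorem4 :
    -- the Schur functions form a basis, so that `schurMap` identifies `F` with `Λ_ℂ`
    Function.Bijective schurMap ∧
    -- `perp f` is the Hall adjoint of the multiplication by `f`
    (∀ f g k : SymFun, hallInner (perp f g) k = hallInner g (f * k)) ∧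
    -- the formula; the sum has only finitely many nonzero terms on each element
    ∀ (m : ℕ) (hm : 1 ≤ m) (n : ℤ) (v : FockSpace),
      (Function.support fun i : ℕ =>
        (-1 : ℂ) ^ i • (plethysmP m hm (hSym (n + i)) *
          perp (plethysmP m hm (eSym i)) (schurMap v))).Finite ∧
      schurMap (phi m (-n) v) =
        ∑ᶠ i : ℕ, (-1 : ℂ) ^ i • (plethysmP m hm (hSym (n + i)) *
          perp (plethysmP m hm (eSym i)) (schurMap v)) :=
  ⟨bijective_schurMap, hallInner_perp, fun _ hm n v =>
    ⟨finite_support_vertexSummand hm n v, schurMap_phi_eq_finsum hm n v⟩⟩
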